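/- A $2$-stack call-return alphabet is a collection $\widetilde\Sigma=\langle\{(\Sigma_c^s,\Sigma_r^s)\}_{s\in\{1,2\}},\Sigma_{\mathit{int}}\rangle$ of pairwise disjoint finite sets; let $\Sigma$ be their union, $\Sigma_c=\Sigma_c^1\cup\Sigma_c^2$ and $\Sigma_r=\Sigma_r^1\cup\Sigma_r^2$. A string over $\Sigma$ is $s$-well formed if it is generated by the grammar $N ::= aNb \mid NN \mid \varepsilon \mid c$ with $a\in\Sigma_c^s$, $b\in\Sigma_r^s$, $c\in\Sigma\setminus(\Sigma_c^s\cup\Sigma_r^s)$. An infinite nested word over $\widetilde\Sigma$ is a structure $W=(\mathbb N_+,\lessdot,\mu,\lambda)$ with $\lessdot=\{(i,i+1)\mid i\in\mathbb N_+\}$, $\lambda:\mathbb N_+\to\Sigma$ and $\mu=\mu^1\cup\mu^2$, where $(i,j)\in\mu^s$ iff $i<j$, $\lambda(i)\in\Sigma_c^s$, $\lambda(j)\in\Sigma_r^s$ and $\lambda(i+1)\cdots\lambda(j-1)$ is $s$-well formed. It is determined by its string $\lambda(1)\lambda(2)\cdots\in\Sigma^\omega$; write $\mathrm{nested}(w)$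 for the infinite nested word with string $w$, and $\mathbb{NW}^\omega(\widetilde\Sigma)$ for the set of all infinite nested words. A Büchi $2$-stack visibly pushdown automaton (Büchi 2VPA) over $\widetilde\Sigma$ is a tuple $\mathcal A=(Q,\Gamma,\delta,Q_I,F)$ with finite sets $Q$ (states) and $\Gamma\ni\bot$ (stack alphabet), $Q_I,F\subseteq Q$, and $\delta=\langle\delta_c,\delta_r,\delta_{\mathit{int}}\rangle$ with $\delta_c\subseteq Q\times\Sigma_c\times(\Gamma\setminus\{\bot\})\times Q$, $\delta_r\subseteq Q\times\Sigma_r\times\Gamma\times Q$, $\delta_{\mathit{int}}\subseteq Q\times\Sigma_{\mathit{int}}\times Q$. A run on $w=a_1a_2\cdots\in\Sigma^\omega$ is a sequence of configurations $(q_i,\sigma_i^1,\sigma_i^2)_{i\ge0}$ with $q_i\in Q$ and $\sigma_i^s\in(\Gamma\setminus\{\bot\})^*\{\bot\}$ (top of the stack to the left) such that $q_0\in Q_I$, $\sigma_0^1=\sigma_0^2=\bot$, and for all $i\ge1$: - if $a_i\in\Sigma_c^s$, there is $B\in\Gamma\setminus\{\bot\}$ with $(q_{i-1},a_i,B,q_i)\in\delta_c$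 and $\sigma_i^s=B\sigma_{i-1}^s$, the other stack being unchanged; - if $a_i\in\Sigma_r^s$, there is $B\in\Gamma$ with $(q_{i-1},a_i,B,q_i)\in\delta_r$ and either $B\ne\bot$ and $\sigma_{i-1}^s=B\sigma_i^s$, or $B=\bot$ and $\sigma_{i-1}^s=\sigma_i^s=\bot$, the other stack being unchanged; - if $a_i\in\Sigma_{\mathit{int}}$, then $(q_{i-1},a_i,q_i)\in\delta_{\mathit{int}}$ and both stacks are unchanged. The run is accepting if some $q\in F$ equals $q_i$ for infinitely many $i$. Let $\mathcal L^\omega(\mathcal A)$ be the set of all $\mathrm{nested}(w)$ such that $\mathcal A$ has an accepting run on $w$. The formulas of $\mathrm{MSO}^\infty(\tau_{\widetilde\Sigma})$ are given by $$\varphi ::= \lambda(x)=a \mid x\lessdot y \mid \mu(x,y) \mid x=y \mid x\in X \mid \neg\varphi \mid \varphi\vee\varphi \mid \exists x\,\varphi \mid \exists^\infty x\,\varphi \mid \exists X\,\varphi \qquad (a\in\Sigma),$$ where $x,y$ range over positions and $X$ over sets of positions, interpreted as usual, and $\exists^\infty x\,\varphi$ means that $\varphi$ holds for infinitely many positions $x$.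 $\mathrm{FO}^\infty(\tau_{\widetilde\Sigma})$ consists of the formulas without second-order quantifiers, and $\mathrm{EMSO}^\infty(\tau_{\widetilde\Sigma})$ of the formulas $\exists X_1\cdots\exists X_n\,\varphi$ with $n\ge0$ and $\varphi\in\mathrm{FO}^\infty(\tau_{\widetilde\Sigma})$. For a sentence $\varphi$ (no free variables), $\mathcal L^\omega(\varphi)$ is the set of infinite nested words satisfying $\varphi$. **Theorem.** Let $\widetilde\Sigma$ be a $2$-stack call-return alphabet and let $\mathcal L\subseteq\mathbb{NW}^\omega(\widetilde\Sigma)$ be a set of infinite nested words over $\widetilde\Sigma$. The following are equivalent: 1. There is a Büchi 2VPA $\mathcal A$ over $\widetilde\Sigma$ such that $\mathcal L^\omega(\mathcal A)=\mathcal L$. 2. There is a sentence $\varphi\in\mathrm{EMSO}^\infty(\tau_{\widetilde\Sigma})$ such that $\mathcal L^\omega(\varphi)=\mathcal L$. -/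

import Mathlib

namespace NestedWords

/-- The role of a letter of a `K`-stack call-return alphabet. -/
inductive LetterKind (K : ℕ) : Type
  | call (s : Fin K)
  | ret (s : Fin K)
  | int

/-- A `K`-stack call-return alphabet whose letters are the elements of `A`. Giving pairwise disjoint
sets `Σ_c^s`, `Σ_r^s` (`s < K`) and `Σ_int` with union `A` amounts to giving every letter its kind:
`Σ_c^s`, `Σ_r^s`, `Σ_int` are the fibres of `kind` over `call s`, `ret s` and `int`. -/
structure CallReturnAlphabet (K : ℕ) (A : Type*) where
  kind : A → LetterKind K

variable {K : ℕ} {A : Type*}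

namespace CallReturnAlphabet

/-- `a ∈ Σ_c^s` -/
def IsCall (S : CallReturnAlphabet K A) (s : Fin K) (a : A) : Prop := S.kind a = .call s

/-- `a ∈ Σ_r^s` -/
def IsReturn (S : CallReturnAlphabet K A) (s : Fin K) (a : A) : Prop := S.kind a = .ret s

/-- `a ∈ Σ_int` -/
def IsInternal (S : CallReturnAlphabet K A) (a : A) : Prop := S.kind a = .int

end CallReturnAlphabet

/-! ### Büchi multi-stack visibly pushdown automata -/

/-- A (Büchi) multi-stack visibly pushdown automaton `(Q, Γ, δ, Q_I, F)`. -/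
structure BuchiMVPA (S : CallReturnAlphabet K A) where
  /-- the set `Q` of states -/
  State : Type
  finite_state : Finite State
  /-- the stack alphabet `Γ` -/
  Stack : Type
  finite_stack : Finite Stack
  /-- the special symbol `⊥` of `Γ` -/
  bot : Stack
  /-- `δ_c ⊆ Q × Σ_c × (Γ \ {⊥}) × Q` -/
  callTrans : Set (State × A × Stack × State)
  callTrans_spec : ∀ q a B q', (q, a, B, q') ∈ callTrans → (∃ s, S.IsCall s a) ∧ B ≠ bot
  /-- `δ_r ⊆ Q × Σ_r × Γ × Q` -/
  retTrans : Set (State × A × Stack × State)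
  retTrans_spec : ∀ q a B q', (q, a, B, q') ∈ retTrans → ∃ s, S.IsReturn s a
  /-- `δ_int ⊆ Q × Σ_int × Q` -/
  intTrans : Set (State × A × State)
  intTrans_spec : ∀ q a q', (q, a, q') ∈ intTrans → S.IsInternal a
  /-- the set `Q_I` of initial states -/
  init : Set State
  /-- the set `F` of final states -/
  final : Set State

namespace BuchiMVPA

variable {S : CallReturnAlphabet K A}

/-- `Cont = (Γ \ {⊥})* · {⊥}`; the head of the list is the top of the stack. -/
def Cont (M : BuchiMVPA S) : Set (List M.Stack) :=
  {σ | ∃ u : List M.Stack, (∀ B ∈ u, B ≠ M.bot) ∧ σ = u ++ [M.bot]}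

/-- The step relation between the configurations `(q, σ)` and `(q', σ')` on reading `a`. -/
structure Step (M : BuchiMVPA S) (a : A) (q : M.State) (σ : Fin K → List M.Stack)
    (q' : M.State) (σ' : Fin K → List M.Stack) : Prop where
  push : ∀ s, S.IsCall s a → ∃ B, B ≠ M.bot ∧ (q, a, B, q') ∈ M.callTrans ∧
    σ' s = B :: σ s ∧ ∀ t, t ≠ s → σ' t = σ t
  pop : ∀ s, S.IsReturn s a → ∃ B, (q, a, B, q') ∈ M.retTrans ∧
    (∀ t, t ≠ s → σ' t = σ t) ∧
    ((B ≠ M.bot ∧ σ s = B :: σ' s) ∨ (B = M.bot ∧ σ s = [M.bot] ∧ σ' s = [M.bot]))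
  internal : S.IsInternal a → (q, a, q') ∈ M.intTrans ∧ ∀ t, σ' t = σ t

/-- A run on the infinite string `w 0, w 1, …` is an infinite sequence of configurations
`(q 0, σ 0), (q 1, σ 1), …`, where the letter `w i` is read between the configurations
number `i` and `i + 1`. -/
structure IsRun (M : BuchiMVPA S) (w : ℕ → A) (q : ℕ → M.State)
    (σ : ℕ → Fin K → List M.Stack) : Prop where
  cont : ∀ i s, σ i s ∈ M.Cont
  start_state : q 0 ∈ M.init
  start_stack : ∀ s, σ 0 s = [M.bot]
  step : ∀ i, M.Step (w i) (q i) (σ i) (q (i + 1)) (σ (i + 1))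

/-- Büchi acceptance: some final state occurs infinitely often. -/
def IsAccepting (M : BuchiMVPA S) (q : ℕ → M.State) : Prop :=
  ({p | {i | q i = p}.Infinite} ∩ M.final).Nonempty

/-- The set of infinite strings accepted by `M`. -/
def stringLanguage (M : BuchiMVPA S) : Set (ℕ → A) :=
  {w | ∃ q σ, M.IsRun w q σ ∧ M.IsAccepting q}

end BuchiMVPA

/-! ### Infinite nested words -/

/-- `s`-well formed strings: those generated by the context-free grammar
`N ::= a N b | N N | ε | c` with `a ∈ Σ_c^s`, `b ∈ Σ_r^s` and `c` in neither of the two. -/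
inductive WellFormed (S : CallReturnAlphabet K A) (s : Fin K) : List A → Prop
  | nest (a b : A) (u : List A) (ha : S.IsCall s a) (hb : S.IsReturn s b)
      (hu : WellFormed S s u) : WellFormed S s (a :: (u ++ [b]))
  | append (u v : List A) (hu : WellFormed S s u) (hv : WellFormed S s v) :
      WellFormed S s (u ++ v)
  | nil : WellFormed S s []
  | single (c : A) (hc : ¬ S.IsCall s c) (hr : ¬ S.IsReturn s c) : WellFormed S s [c]

/-- The matching relation `μ^s` of the infinite string `w`: position `i` carries a call and
position `j > i` a return of stack `s`, and the string strictly between them is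
`s`-well formed. -/
def Matching (S : CallReturnAlphabet K A) (w : ℕ → A) (s : Fin K) (i j : ℕ) : Prop :=
  i < j ∧ S.IsCall s (w i) ∧ S.IsReturn s (w j) ∧ WellFormed S s ((List.Ico (i + 1) j).map w)

/-- An infinite nested word. Positions are numbered `0, 1, 2, …` (instead of `1, 2, 3, …`), `lam`
is the labelling, `succ` the direct successor relation and `mu` the union over all stacks of the
matching relations. -/
structure InfNestedWord (S : CallReturnAlphabet K A) where
  succ : ℕ → ℕ → Prop
  mu : ℕ → ℕ → Prop
  lam : ℕ → A
  succ_iff : ∀ i j, succ i j ↔ j = i + 1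
  mu_iff : ∀ i j, mu i j ↔ ∃ s, Matching S lam s i j

/-- The unique infinite nested word with underlying string `w`. -/
def nested (S : CallReturnAlphabet K A) (w : ℕ → A) : InfNestedWord S where
  succ i j := j = i + 1
  mu i j := ∃ s, Matching S w s i j
  lam := w
  succ_iff _ _ := Iff.rfl
  mu_iff _ _ := Iff.rfl

/-- The set of infinite nested words `nested w` with `w` accepted by `M`. -/
def BuchiMVPA.language {S : CallReturnAlphabet K A} (M : BuchiMVPA S) : Set (InfNestedWord S) :=
  nested S '' M.stringLanguage

/-! ### Monadic second-order logic with the infinity quantifier -/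

/-- Formulas of `MSO^∞`. First-order and second-order variables are both named by natural
numbers (two separate supplies). -/
inductive Formula (A : Type*)
  /-- `λ(x) = a` -/
  | label (x : ℕ) (a : A)
  /-- `y` is the direct successor of `x` -/
  | succ (x y : ℕ)
  /-- `μ(x, y)` -/
  | mu (x y : ℕ)
  /-- `x = y` -/
  | eq (x y : ℕ)
  /-- `x ∈ X` -/
  | mem (x X : ℕ)
  | not (φ : Formula A)
  | or (φ ψ : Formula A)
  /-- `∃ x φ` -/
  | ex (x : ℕ) (φ : Formula A)
  /-- `∃^∞ x φ` -/
  | exInf (x : ℕ) (φ : Formula A)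
  /-- `∃ X φ` -/
  | exSet (X : ℕ) (φ : Formula A)

namespace Formula

/-- The free first-order variables. -/
def freeVars : Formula A → Set ℕ
  | label x _ => {x}
  | succ x y => {x, y}
  | mu x y => {x, y}
  | eq x y => {x, y}
  | mem x _ => {x}
  | not φ => φ.freeVars
  | or φ ψ => φ.freeVars ∪ ψ.freeVars
  | ex x φ => φ.freeVars \ {x}
  | exInf x φ => φ.freeVars \ {x}
  | exSet _ φ => φ.freeVars

/-- The free second-order variables. -/
def freeSetVars : Formula A → Set ℕ
  | label _ _ => ∅
  | succ _ _ => ∅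
  | mu _ _ => ∅
  | eq _ _ => ∅
  | mem _ X => {X}
  | not φ => φ.freeSetVars
  | or φ ψ => φ.freeSetVars ∪ ψ.freeSetVars
  | ex _ φ => φ.freeSetVars
  | exInf _ φ => φ.freeSetVars
  | exSet X φ => φ.freeSetVars \ {X}

/-- A sentence is a formula without free variables. -/
def IsSentence (φ : Formula A) : Prop := φ.freeVars = ∅ ∧ φ.freeSetVars = ∅

/-- The fragment `FO^∞`: no second-order quantifier. -/
def IsFO : Formula A → Prop
  | label _ _ => True
  | succ _ _ => True
  | mu _ _ => True
  | eq _ _ => True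
  | mem _ _ => True
  | not φ => φ.IsFO
  | or φ ψ => φ.IsFO ∧ ψ.IsFO
  | ex _ φ => φ.IsFO
  | exInf _ φ => φ.IsFO
  | exSet _ _ => False

/-- The fragment `EMSO^∞`: formulas `∃ X₁ … ∃ Xₙ φ` with `φ` in `FO^∞`. -/
inductive IsEMSO : Formula A → Prop
  | base (φ : Formula A) (h : φ.IsFO) : IsEMSO φ
  | exSet (X : ℕ) (φ : Formula A) (h : IsEMSO φ) : IsEMSO (exSet X φ)

/-- `Sat W v V φ`: the infinite nested word `W` satisfies `φ` when the first-order variables are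
interpreted by `v` and the second-order variables by `V`. -/
def Sat {S : CallReturnAlphabet K A} (W : InfNestedWord S) :
    (ℕ → ℕ) → (ℕ → Set ℕ) → Formula A → Prop
  | v, _, label x a => W.lam (v x) = a
  | v, _, succ x y => W.succ (v x) (v y)
  | v, _, mu x y => W.mu (v x) (v y)
  | v, _, eq x y => v x = v y
  | v, V, mem x X => v x ∈ V X
  | v, V, not φ => ¬ Sat W v V φ
  | v, V, or φ ψ => Sat W v V φ ∨ Sat W v V ψ
  | v, V, ex x φ => ∃ i : ℕ, Sat W (Function.update v x i) V φ
  | v, V, exInf x φ => {i : ℕ | Sat W (Function.update v x i) V φ}.Infinite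
  | v, V, exSet X φ => ∃ I : Set ℕ, Sat W v (Function.update V X I) φ

/-- The set of infinite nested words satisfying the sentence `φ` (for a sentence, the truth value
does not depend on the interpretation of the variables). -/
def language (S : CallReturnAlphabet K A) (φ : Formula A) : Set (InfNestedWord S) :=
  {W | ∀ v V, Sat W v V φ}

end Formula

end NestedWords

/-!
The theorem rests on Hanf's locality principle and on the planarity of nested words over two stacks.

*From formulas to automata.* An infinite nested word is a graph of bounded degree: a position has a
successor, a predecessor and at most one matching partner. Hence, as in Hanf's theorem, the truth of
a sentence of first-order logic with the infinity quantifier depends only on how often, up to a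
threshold and infinity, each local type of some radius `R` occurs (`exists_radius_threshold`), where
the local type of a position records the letters reached by at most `R` moves and which of these
walks are closed. Counting is easy for a Büchi automaton, so everything reduces to the claim that an
automaton can guess the local types of all positions and verify its guess (`recognizable_localType`,
`recognizable_of_countEq`). Set quantifiers are then dealt with by projection.

What an automaton verifies are constraints along successor edges and matching edges (a `Tiling`),
since the symbol pushed by a call is read by the matching return. That a call is *never* popped is
certified by a Büchi condition (`Recognizable.unmatched_call`). The letters in a guessed local type
are verified step by step along the moves, and a closed walk that is guessed not to be closed is
exposed by a proper colouring, in which distinct positions at distance at most `R` have distinct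
colours. The crux is a walk `w` that is guessed to be closed but is not
(`Certificate.loop_sound_step`). Take `w` of minimal length. Repeating `w` yields an infinite walk
which, by the colouring and by minimality, meets itself only at corresponding points of different
repetitions; in the nested word from which the guessed local type is taken, `w` is a simple closed
walk. With the matching edges of one stack drawn above and those of the other one below the line of
positions, no edges cross. So the turning number of `w` is `±1` by the Umlaufsatz
(`sum_turn_closed`, where half turns are counted), while a simple closed walk consisting of `m ≥ 2`
repetitions of `w` would have turning number `±m`, and a simple infinite walk cannot turn
in the same direction for ever, because by Hopf's formula (`sum_turn_eq`) its parts from the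
leftmost position to a new rightmost one have total turning zero. This is `closed_of_closed`, the only place where the number of stacks matters.

*From automata to formulas.* Since the stack contents can be eliminated from runs
(`BuchiMVPA.mem_stringLanguage_iff`), an accepting run is a labelling of the positions by states and
pushed symbols with first-order definable properties; it is described by existentially quantified
sets (`BuchiMVPA.runFormula`).
-/

namespace NestedWords

variable {K : ℕ} {A : Type*}

/-! ### Pending calls and the matching relation -/

open Classical in
/-- The positions of the calls of stack `s` that are pending after the first `i` letters, the most
recent one first. -/
noncomputable def pending (κ : ℕ → LetterKind K) (s : Fin K) : ℕ → List ℕ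
  | 0 => []
  | i + 1 =>
    if κ i = .call s then i :: pending κ s i
    else if κ i = .ret s then (pending κ s i).tail else pending κ s i

/-- The return `j` pops the call `i` from stack `s`. -/
def Matched (κ : ℕ → LetterKind K) (s : Fin K) (i j : ℕ) : Prop :=
  κ j = .ret s ∧ (pending κ s j).head? = some i

section Pending

variable {κ : ℕ → LetterKind K} {s : Fin K} {i j : ℕ}

theorem pending_succ_call (h : κ i = .call s) : pending κ s (i + 1) = i :: pending κ s i := by
  simp [pending, h]

theorem pending_succ_ret (h : κ i = .ret s) : pending κ s (i + 1) = (pending κ s i).tail := by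
  simp [pending, h]

theorem pending_succ_other (h : κ i ≠ .call s) (h' : κ i ≠ .ret s) :
    pending κ s (i + 1) = pending κ s i := by
  simp [pending, h, h']

theorem lt_of_mem_pending (h : i ∈ pending κ s j) : i < j := by
  induction j with
  | zero => simp [pending] at h
  | succ j ih =>
    unfold pending at h
    split_ifs at h
    · rcases List.mem_cons.1 h with rfl | h
      · omega
      · have := ih h; omega
    · have := ih (List.mem_of_mem_tail h); omega
    · have := ih h; omega

theorem pending_pairwise : (pending κ s j).Pairwise (· > ·) := by
  induction j with
  | zero => simp [pending]
  | succ j ih =>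
    unfold pending
    split_ifs
    · exact List.pairwise_cons.2 ⟨fun a ha => lt_of_mem_pending ha, ih⟩
    · exact ih.tail
    · exact ih

/-- What lies on top of the stack determines the rest of it: below the call `i` there are the calls
that were pending when `i` was pushed. -/
theorem pending_eq_cons {l : List ℕ} (h : pending κ s j = i :: l) :
    κ i = .call s ∧ pending κ s i = l := by
  induction j using Nat.strong_induction_on generalizing i l with
  | _ j ih =>
    match j, h with
    | 0, h => simp [pending] at h
    | j + 1, h =>
      unfold pending at h
      split_ifs at h with h1 h2
      · simp only [List.cons.injEq] at h
        obtain ⟨rfl, rfl⟩ := h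
        exact ⟨h1, rfl⟩
      · match hj : pending κ s j with
        | [] => rw [hj] at h; simp at h
        | k :: l' =>
          rw [hj] at h
          simp only [List.tail_cons] at h
          subst h
          have hk : k < j := lt_of_mem_pending (κ := κ) (s := s) (by rw [hj]; simp)
          exact ih k (by omega) (ih j (by omega) hj).2
      · exact ih j (by omega) h

theorem mem_pending_of_mem {m : ℕ} (h : i ∈ pending κ s j) (hm : i < m) (hmj : m ≤ j) :
    i ∈ pending κ s m := by
  induction j with
  | zero => simp [pending] at h
  | succ j ih =>
    rcases Nat.lt_or_ge j m with hj | hj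
    · obtain rfl : m = j + 1 := by omega
      exact h
    · have h' : i ∈ pending κ s j := by
        unfold pending at h
        split_ifs at h
        · rcases List.mem_cons.1 h with rfl | h
          · omega
          · exact h
        · exact List.mem_of_mem_tail h
        · exact h
      exact ih h' hj

theorem call_of_mem_pending (h : i ∈ pending κ s j) : κ i = .call s := by
  have h1 := mem_pending_of_mem h (Nat.lt_succ_self i) (lt_of_mem_pending h)
  unfold pending at h1
  split_ifs at h1 with h2 h3
  · exact h2
  · exact absurd (lt_of_mem_pending (List.mem_of_mem_tail h1)) (lt_irrefl _)
  · exact absurd (lt_of_mem_pending h1) (lt_irrefl _)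

namespace Matched

theorem pending_eq (h : Matched κ s i j) : pending κ s j = i :: pending κ s i := by
  obtain ⟨-, h⟩ := h
  match hj : pending κ s j with
  | [] => simp [hj] at h
  | k :: l =>
    simp only [hj, List.head?_cons, Option.some.injEq] at h
    subst h
    rw [(pending_eq_cons hj).2]

theorem mem (h : Matched κ s i j) : i ∈ pending κ s j := by simp [h.pending_eq]

theorem lt (h : Matched κ s i j) : i < j := lt_of_mem_pending h.mem

theorem call (h : Matched κ s i j) : κ i = .call s := call_of_mem_pending h.mem

theorem ret (h : Matched κ s i j) : κ j = .ret s := h.1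

theorem pending_succ (h : Matched κ s i j) : pending κ s (j + 1) = pending κ s i := by
  rw [pending_succ_ret h.ret, h.pending_eq, List.tail_cons]

theorem not_mem_of_lt {m : ℕ} (h : Matched κ s i j) (hm : j < m) : i ∉ pending κ s m := by
  intro hi
  have h1 := mem_pending_of_mem hi (m := j + 1) (by have := h.lt; omega) hm
  rw [h.pending_succ] at h1
  exact absurd (lt_of_mem_pending h1) (lt_irrefl _)

theorem left_unique {i' : ℕ} (h : Matched κ s i j) (h' : Matched κ s i' j) : i = i' := by
  have := h.2.symm.trans h'.2
  simpa using this

theorem right_unique {j' : ℕ} (h : Matched κ s i j) (h' : Matched κ s i j') : j = j' := by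
  rcases lt_trichotomy j j' with hlt | heq | hlt
  · exact absurd h'.mem (h.not_mem_of_lt hlt)
  · exact heq
  · exact absurd h.mem (h'.not_mem_of_lt hlt)

/-- A pending call that is still pending when `i` is popped lies below `i`. -/
theorem le_of_mem {p : ℕ} (h : Matched κ s i j) (hp : p ∈ pending κ s j) : p ≤ i := by
  have hs := pending_pairwise (κ := κ) (s := s) (j := j)
  rw [h.pending_eq] at hs hp
  rcases List.mem_cons.1 hp with rfl | hp
  · exact le_rfl
  · exact ((List.pairwise_cons.1 hs).1 p hp).le

/-- The matched pairs of one stack do not cross. -/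
theorem noncrossing {i' j' : ℕ} (h : Matched κ s i j) (h' : Matched κ s i' j')
    (h1 : i < i') (h2 : i' < j) (h3 : j < j') : False := by
  have := h.le_of_mem (mem_pending_of_mem h'.mem h2 h3.le)
  omega

end Matched

/-- A call that is never popped stays on the stack. -/
theorem mem_pending_of_unmatched (hc : κ i = .call s) (hu : ∀ j, ¬ Matched κ s i j) {m : ℕ}
    (hm : i < m) : i ∈ pending κ s m := by
  induction m with
  | zero => omega
  | succ m ih =>
    rcases Nat.lt_or_ge i m with h | h
    · have := ih h
      unfold pending
      split_ifs with h1 h2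
      · exact List.mem_cons_of_mem _ this
      · match hj : pending κ s m with
        | [] => simp [hj] at this
        | k :: l =>
          rw [hj] at this
          rcases List.mem_cons.1 this with rfl | h3
          · exact absurd ⟨h2, by simp [hj]⟩ (hu m)
          · exact h3
      · exact this
    · obtain rfl : i = m := by omega
      rw [pending_succ_call hc]
      simp

theorem exists_matched_of_ret (h : κ j = .ret s) (hp : pending κ s j ≠ []) :
    ∃ i, Matched κ s i j := by
  match hj : pending κ s j with
  | [] => exact absurd hj hp
  | k :: l => exact ⟨k, h, by simp [hj]⟩

theorem Matched.pending_ne_nil (h : Matched κ s i j) : pending κ s j ≠ [] := by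
  simp [h.pending_eq]

theorem matched_succ (h : κ i = .call s) (h' : κ (i + 1) = .ret s) : Matched κ s i (i + 1) :=
  ⟨h', by simp [pending_succ_call h]⟩

end Pending

theorem WellFormed.pending_eq {S : CallReturnAlphabet K A} {w : ℕ → A} {s : Fin K} {u : List A}
    (hu : WellFormed S s u) : ∀ p, u = (List.Ico p (p + u.length)).map w →
      pending (S.kind ∘ w) s (p + u.length) = pending (S.kind ∘ w) s p := by
  induction hu with
  | nest a b u ha hb hu ih =>
    intro p hp
    have hlen : (a :: (u ++ [b])).length = u.length + 2 := by simp
    rw [hlen] at hp ⊢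
    rw [List.Ico.eq_cons (by omega), show p + (u.length + 2) = p + 1 + u.length + 1 by omega,
      List.Ico.succ_top (by omega)] at hp
    simp only [List.map_cons, List.map_append, List.cons.injEq, List.map_nil] at hp
    obtain ⟨h1, h2⟩ := hp
    have h3 := List.append_inj' h2 rfl
    have hcall : (S.kind ∘ w) p = .call s := by
      simpa [h1, CallReturnAlphabet.IsCall] using ha
    have hret : (S.kind ∘ w) (p + 1 + u.length) = .ret s := by
      have : b = w (p + 1 + u.length) := by simpa using h3.2
      simpa [← this, CallReturnAlphabet.IsReturn] using hb
    have := ih (p + 1) h3.1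
    rw [show p + (u.length + 2) = p + 1 + u.length + 1 by omega, pending_succ_ret hret, this,
      pending_succ_call hcall, List.tail_cons]
  | append u v hu hv ihu ihv =>
    intro p hp
    rw [List.length_append, ← add_assoc,
      ← List.Ico.append_consecutive (Nat.le_add_right p u.length) (Nat.le_add_right _ _),
      List.map_append] at hp
    have h := List.append_inj hp (by simp)
    rw [List.length_append, ← add_assoc, ihv _ h.2, ihu _ h.1]
  | nil => intro p _; simp
  | single c hc hr =>
    intro p hp
    have h : c = w p := by simpa using hp
    have h1 : (S.kind ∘ w) p ≠ .call s := by simpa [← h, CallReturnAlphabet.IsCall] using hc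
    have h2 : (S.kind ∘ w) p ≠ .ret s := by simpa [← h, CallReturnAlphabet.IsReturn] using hr
    exact pending_succ_other h1 h2

theorem wellFormed_of_pending {S : CallReturnAlphabet K A} {w : ℕ → A} {s : Fin K} {i j : ℕ}
    {l : List ℕ} (h : pending (S.kind ∘ w) s j = i :: l) :
    WellFormed S s ((List.Ico (i + 1) j).map w) := by
  induction j using Nat.strong_induction_on generalizing i l with
  | _ j ih =>
    match j, h with
    | 0, h => simp [pending] at h
    | j + 1, h =>
      unfold pending at h
      split_ifs at h with h1 h2
      · simp only [List.cons.injEq] at h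
        obtain ⟨rfl, rfl⟩ := h
        simpa using WellFormed.nil
      · match hj : pending (S.kind ∘ w) s j with
        | [] => rw [hj] at h; simp at h
        | k :: l' =>
          rw [hj] at h
          simp only [List.tail_cons] at h
          subst h
          have hk : k < j := lt_of_mem_pending (κ := S.kind ∘ w) (s := s) (by rw [hj]; simp)
          have hk2 := pending_eq_cons hj
          have hik : i < k := lt_of_mem_pending (κ := S.kind ∘ w) (s := s) (by rw [hk2.2]; simp)
          have w1 := ih j (by omega) hj
          have w2 := ih k (by omega) hk2.2
          rw [← List.Ico.append_consecutive (m := k) (by omega) (by omega), List.map_append,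
            List.Ico.eq_cons (n := k) (by omega), List.Ico.succ_top (by omega), List.map_cons,
            List.map_append]
          exact .append _ _ w2 (.nest _ _ _ hk2.1 h2 w1)
      · have hi := lt_of_mem_pending (κ := S.kind ∘ w) (s := s) (i := i) (j := j) (by simp [h])
        rw [List.Ico.succ_top (by omega), List.map_append]
        exact .append _ _ (ih j (by omega) h) (.single _ h1 h2)

theorem matching_iff_matched (S : CallReturnAlphabet K A) (w : ℕ → A) (s : Fin K) (i j : ℕ) :
    Matching S w s i j ↔ Matched (S.kind ∘ w) s i j := by
  constructor
  · rintro ⟨hij, hc, hr, hw⟩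
    refine ⟨hr, ?_⟩
    have := hw.pending_eq (w := w) (i + 1) (by
      simp [show i + 1 + (j - (i + 1)) = j by omega])
    simp only [List.length_map, List.Ico.length, show i + 1 + (j - (i + 1)) = j by omega] at this
    rw [this, pending_succ_call (show (S.kind ∘ w) i = .call s from hc)]
    rfl
  · intro h
    exact ⟨h.lt, h.call, h.ret, wellFormed_of_pending h.pending_eq⟩

/-! ### Acceptance without configurations -/

/-- The words accepted by an automaton, with the stack contents eliminated: it is enough to record
for every call the symbol it pushes, since the symbol read by a return is the one pushed by the
matching call, and `⊥` if there is none. -/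
theorem BuchiMVPA.mem_stringLanguage_iff {S : CallReturnAlphabet K A} (M : BuchiMVPA S)
    (w : ℕ → A) :
    w ∈ M.stringLanguage ↔ ∃ (q : ℕ → M.State) (B : ℕ → M.Stack), q 0 ∈ M.init ∧
      (∀ i s, S.IsCall s (w i) → (q i, w i, B i, q (i + 1)) ∈ M.callTrans) ∧
      (∀ i j s, Matched (S.kind ∘ w) s i j → (q j, w j, B i, q (j + 1)) ∈ M.retTrans) ∧
      (∀ j s, S.IsReturn s (w j) → pending (S.kind ∘ w) s j = [] →
        (q j, w j, M.bot, q (j + 1)) ∈ M.retTrans) ∧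
      (∀ i, S.IsInternal (w i) → (q i, w i, q (i + 1)) ∈ M.intTrans) ∧
      {i | q i ∈ M.final}.Infinite := by
  have hacc : ∀ q : ℕ → M.State, M.IsAccepting q ↔ {i | q i ∈ M.final}.Infinite := by
    intro q
    have := M.finite_state
    constructor
    · rintro ⟨p, hp, hF⟩
      refine Set.Infinite.mono ?_ hp
      rintro i rfl
      exact hF
    · intro h
      by_contra hne
      refine h (((Set.toFinite M.final).biUnion (t := fun p => {i | q i = p}) ?_).subset ?_)
      · intro p hp
        by_contra hinf
        exact hne ⟨p, hinf, hp⟩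
      · intro i hi
        exact Set.mem_biUnion (x := q i) hi rfl
  constructor
  · rintro ⟨q, σ, hrun, hq⟩
    have hB : ∀ i, ∃ B, ∀ s, S.IsCall s (w i) → B ≠ M.bot ∧
        (q i, w i, B, q (i + 1)) ∈ M.callTrans ∧ σ (i + 1) s = B :: σ i s := by
      intro i
      by_cases h : ∃ s, S.IsCall s (w i)
      · obtain ⟨s, hs⟩ := h
        obtain ⟨B, h1, h2, h3, -⟩ := (hrun.step i).push s hs
        refine ⟨B, fun s' hs' => ?_⟩
        have : LetterKind.call s = LetterKind.call s' := hs.symm.trans hs'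
        simp only [LetterKind.call.injEq] at this
        subst this
        exact ⟨h1, h2, h3⟩
      · exact ⟨M.bot, fun s hs => absurd ⟨s, hs⟩ h⟩
    choose B hB using hB
    have hσ : ∀ i s, σ i s = (pending (S.kind ∘ w) s i).map B ++ [M.bot] := by
      intro i s
      induction i with
      | zero => simpa [pending] using hrun.start_stack s
      | succ i ih =>
        by_cases hc : S.IsCall s (w i)
        · rw [pending_succ_call (show (S.kind ∘ w) i = .call s from hc), (hB i s hc).2.2, ih]
          rfl
        by_cases hr : S.IsReturn s (w i)
        · rw [pending_succ_ret (show (S.kind ∘ w) i = .ret s from hr)]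
          obtain ⟨C, -, -, h⟩ := (hrun.step i).pop s hr
          match hp : pending (S.kind ∘ w) s i with
          | [] =>
            rw [hp] at ih
            rcases h with ⟨h1, h2⟩ | ⟨-, -, h3⟩
            · rw [ih] at h2
              simp only [List.map_nil, List.nil_append, List.cons.injEq] at h2
              exact absurd h2.1.symm h1
            · simpa using h3
          | k :: l =>
            rw [hp] at ih
            rcases h with ⟨h1, h2⟩ | ⟨-, h2, h3⟩
            · rw [ih] at h2
              simp only [List.map_cons, List.cons_append, List.cons.injEq] at h2
              exact h2.2.symm
            · rw [ih] at h2
              simp at h2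
        · rw [pending_succ_other (show (S.kind ∘ w) i ≠ .call s from hc)
            (show (S.kind ∘ w) i ≠ .ret s from hr), ← ih]
          match hk : S.kind (w i) with
          | .call t =>
            obtain ⟨_, -, -, -, h⟩ := (hrun.step i).push t hk
            exact h s (by rintro rfl; exact hc hk)
          | .ret t =>
            obtain ⟨_, -, h, -⟩ := (hrun.step i).pop t hk
            exact h s (by rintro rfl; exact hr hk)
          | .int => exact ((hrun.step i).internal hk).2 s
    refine ⟨q, B, hrun.start_state, fun i s h => (hB i s h).2.1, ?_, ?_, fun i h =>
      ((hrun.step i).internal h).1, (hacc q).1 hq⟩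
    · intro i j s h
      obtain ⟨C, h1, -, h2⟩ := (hrun.step j).pop s h.ret
      rw [hσ j s, h.pending_eq] at h2
      rcases h2 with ⟨-, h2⟩ | ⟨-, h2, -⟩
      · simp only [List.map_cons, List.cons_append, List.cons.injEq] at h2
        rwa [h2.1]
      · simp at h2
    · intro j s h hp
      obtain ⟨C, h1, -, h2⟩ := (hrun.step j).pop s h
      rw [hσ j s, hp] at h2
      rcases h2 with ⟨h3, h2⟩ | ⟨h2, -⟩
      · simp only [List.map_nil, List.nil_append, List.cons.injEq] at h2
        exact absurd h2.1.symm h3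
      · rwa [← h2]
  · rintro ⟨q, B, h0, hc, hm, hu, hi, hF⟩
    have hne : ∀ i s, S.IsCall s (w i) → B i ≠ M.bot := fun i s h =>
      (M.callTrans_spec _ _ _ _ (hc i s h)).2
    refine ⟨q, fun i s => (pending (S.kind ∘ w) s i).map B ++ [M.bot], ⟨?_, h0, ?_, ?_⟩,
      (hacc q).2 hF⟩
    · intro i s
      refine ⟨_, ?_, rfl⟩
      intro C hC
      obtain ⟨p, hp, rfl⟩ := List.mem_map.1 hC
      exact hne p s (call_of_mem_pending hp)
    · intro s; simp [pending]
    · intro i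
      refine ⟨?_, ?_, ?_⟩
      · intro s hs
        refine ⟨B i, hne i s hs, hc i s hs, ?_, fun t ht => ?_⟩
        · rw [pending_succ_call (show (S.kind ∘ w) i = .call s from hs)]; rfl
        · have hk : (S.kind ∘ w) i = .call s := hs
          rw [pending_succ_other (by rw [hk]; simpa using ht.symm) (by rw [hk]; simp)]
      · intro s hs
        have hk : (S.kind ∘ w) i = .ret s := hs
        have hoth : ∀ t, t ≠ s → (pending (S.kind ∘ w) t (i + 1)).map B ++ [M.bot] =
            (pending (S.kind ∘ w) t i).map B ++ [M.bot] := by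
          intro t ht
          rw [pending_succ_other (by rw [hk]; simp) (by rw [hk]; simpa using ht.symm)]
        by_cases hp : pending (S.kind ∘ w) s i = []
        · exact ⟨M.bot, hu i s hs hp, hoth, .inr ⟨rfl, by simp [hp],
            by simp [pending_succ_ret hk, hp]⟩⟩
        · obtain ⟨p, hp⟩ := exists_matched_of_ret hk hp
          exact ⟨B p, hm p i s hp, hoth, .inl ⟨hne p s hp.call,
            by simp [hp.pending_eq, hp.pending_succ]⟩⟩
      · intro hs
        have hk : (S.kind ∘ w) i = .int := hs
        refine ⟨hi i hs, fun t => ?_⟩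
        rw [pending_succ_other (by rw [hk]; simp) (by rw [hk]; simp)]

/-! ### Tiling systems -/

/-- A tiling system over the alphabet `E`: local constraints on a labelling of the positions, along
the successor edges and along the matching edges, together with finitely many Büchi conditions. -/
structure Tiling (E : Type) where
  /-- letters that may occur -/
  loc : E → Prop
  /-- letters that may occur at position `0` -/
  init : E → Prop
  /-- pairs of letters that may occur at consecutive positions -/
  step : E → E → Prop
  /-- pairs of letters that may occur at a call and the matching return -/
  mat : E → E → Prop
  /-- letters that may occur at an unmatched return -/
  unm : E → Prop
  /-- the index set of the Büchi conditions -/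
  Idx : Type
  finite_idx : Finite Idx
  /-- letters of which infinitely many have to occur -/
  acc : Idx → E → Prop

namespace Tiling

/-- The labelling `e` of the positions, whose letters have the kinds given by `k`, satisfies the
constraints of `T`. -/
structure Holds {E : Type} (T : Tiling E) (k : E → LetterKind K) (e : ℕ → E) : Prop where
  loc : ∀ i, T.loc (e i)
  init : T.init (e 0)
  step : ∀ i, T.step (e i) (e (i + 1))
  mat : ∀ s i j, Matched (k ∘ e) s i j → T.mat (e i) (e j)
  unm : ∀ s j, k (e j) = .ret s → pending (k ∘ e) s j = [] → T.unm (e j)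
  acc : ∀ a, {i | T.acc a (e i)}.Infinite

/-- The tiling system without constraints. -/
def top (E : Type) : Tiling E where
  loc _ := True
  init _ := True
  step _ _ := True
  mat _ _ := True
  unm _ := True
  Idx := Empty
  finite_idx := inferInstance
  acc _ _ := True

/-- Pulling a tiling system back along a map of alphabets. -/
def comap {E F : Type} (f : E → F) (T : Tiling F) : Tiling E where
  loc e := T.loc (f e)
  init e := T.init (f e)
  step e e' := T.step (f e) (f e')
  mat e e' := T.mat (f e) (f e')
  unm e := T.unm (f e)
  Idx := T.Idx
  finite_idx := T.finite_idx
  acc a e := T.acc a (f e)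

theorem holds_comap {E F : Type} (f : E → F) (T : Tiling F) (k : F → LetterKind K)
    (e : ℕ → E) : (T.comap f).Holds (k ∘ f) e ↔ T.Holds k (f ∘ e) :=
  ⟨fun h => ⟨h.loc, h.init, h.step, h.mat, h.unm, h.acc⟩,
    fun h => ⟨h.loc, h.init, h.step, h.mat, h.unm, h.acc⟩⟩

/-- The conjunction of finitely many tiling systems. -/
def all {ι E : Type} [Finite ι] (T : ι → Tiling E) : Tiling E where
  loc e := ∀ a, (T a).loc e
  init e := ∀ a, (T a).init e
  step e e' := ∀ a, (T a).step e e'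
  mat e e' := ∀ a, (T a).mat e e'
  unm e := ∀ a, (T a).unm e
  Idx := Σ a, (T a).Idx
  finite_idx := by
    have := fun a => (T a).finite_idx
    infer_instance
  acc b e := (T b.1).acc b.2 e

theorem holds_all {ι E : Type} [Finite ι] (T : ι → Tiling E) (k : E → LetterKind K)
    (e : ℕ → E) : (all T).Holds k e ↔ ∀ a, (T a).Holds k e :=
  ⟨fun h a => ⟨fun i => h.loc i a, h.init a, fun i => h.step i a, fun s i j hm => h.mat s i j hm a,
      fun s j hr hp => h.unm s j hr hp a, fun b => h.acc ⟨a, b⟩⟩,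
    fun h => ⟨fun i a => (h a).loc i, fun a => (h a).init, fun i a => (h a).step i,
      fun s i j hm a => (h a).mat s i j hm, fun s j hr hp a => (h a).unm s j hr hp,
      fun b => (h b.1).acc b.2⟩⟩

end Tiling

/-! ### Simulating a tiling system by an automaton -/

section Automaton

variable {E : Type} (S : CallReturnAlphabet K A) (ltr : E → A)

/-- The set of Büchi conditions not met since the last reset; it is reset when it is empty. -/
def Tiling.nextGoals (T : Tiling E) (G : Set T.Idx) (e : E) : Set T.Idx :=
  {a | (G = ∅ ∨ a ∈ G) ∧ ¬ T.acc a e}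

/-- The sets of open Büchi conditions along a labelling. -/
def Tiling.goals (T : Tiling E) (e : ℕ → E) : ℕ → Set T.Idx
  | 0 => ∅
  | i + 1 => T.nextGoals (T.goals e i) (e i)

theorem Tiling.goals_infinite_iff (T : Tiling E) (e : ℕ → E) :
    {i | T.goals e i = ∅}.Infinite ↔ ∀ a, {i | T.acc a (e i)}.Infinite := by
  have := T.finite_idx
  constructor
  · intro h a
    rw [Set.infinite_iff_exists_gt] at h ⊢
    intro n
    obtain ⟨i, hi, hni⟩ := h n
    obtain ⟨j, hj, hij⟩ := h i
    by_contra hno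
    -- between two consecutive resets every condition is met
    have : ∀ m, i < m → a ∈ T.goals e m := by
      intro m hm
      induction m with
      | zero => omega
      | succ m ih =>
        refine ⟨?_, fun hacc => hno ⟨m, hacc, by omega⟩⟩
        rcases Nat.lt_or_ge i m with h1 | h1
        · exact .inr (ih h1)
        · obtain rfl : i = m := by omega
          exact .inl hi
    have h2 := this j hij
    rw [show T.goals e j = ∅ from hj] at h2
    exact h2
  · intro h
    rw [Set.infinite_iff_exists_gt]
    intro n
    by_contra hno
    push Not at hno
    have hne : ∀ m, n < m → T.goals e m ≠ ∅ := fun m hm h0 => by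
      have := hno m h0; omega
    have hmono : ∀ m, n < m → ∀ m', m ≤ m' → T.goals e m' ⊆ T.goals e m := by
      intro m hm m' hm'
      induction m', hm' using Nat.le_induction with
      | base => exact subset_rfl
      | succ m' hm' ih =>
        rintro a ⟨h1 | h1, -⟩
        · exact absurd h1 (hne m' (by omega))
        · exact ih h1
    have hex : ∀ a, ∃ m, n < m ∧ a ∉ T.goals e m := by
      intro a
      obtain ⟨i, hi, hni⟩ := (Set.infinite_iff_exists_gt.1 (h a)) n
      exact ⟨i + 1, by omega, fun h1 => h1.2 hi⟩
    choose m hm hm' using hex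
    obtain ⟨b, hb⟩ := (Set.finite_range m).bddAbove
    refine hne (max b (n + 1)) (by omega) (Set.eq_empty_of_forall_notMem fun a ha => ?_)
    exact hm' a (hmono (m a) (hm a) _ ((hb ⟨a, rfl⟩).trans (le_max_left _ _)) ha)

/-- The tile `e` may be placed on the letter `a` after the tile `o`, if any. -/
def Tiling.Fits (T : Tiling E) (o : Option E) (a : A) (e : E) : Prop :=
  ltr e = a ∧ T.loc e ∧ (o = none → T.init e) ∧ ∀ e₀, o = some e₀ → T.step e₀ e

/-- The automaton guessing a labelling that satisfies `T`: its state holds the previous tile and the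
open Büchi conditions, and a call pushes its tile. -/
def Tiling.automaton [Finite E] (T : Tiling E) : BuchiMVPA S where
  State := Option E × Set T.Idx
  finite_state := by have := T.finite_idx; infer_instance
  Stack := Option E
  finite_stack := inferInstance
  bot := none
  callTrans := {x | (∃ s, S.IsCall s x.2.1) ∧ ∃ e, T.Fits ltr x.1.1 x.2.1 e ∧
    x.2.2.1 = some e ∧ x.2.2.2 = (some e, T.nextGoals x.1.2 e)}
  callTrans_spec := by
    rintro q a B q' ⟨h, e, -, h2, -⟩
    exact ⟨h, by simp only at h2; simp [h2]⟩
  retTrans := {x | (∃ s, S.IsReturn s x.2.1) ∧ ∃ e, T.Fits ltr x.1.1 x.2.1 e ∧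
    (x.2.2.1 = none → T.unm e) ∧ (∀ e₀, x.2.2.1 = some e₀ → T.mat e₀ e) ∧
    x.2.2.2 = (some e, T.nextGoals x.1.2 e)}
  retTrans_spec := fun _ _ _ _ h => h.1
  intTrans := {x | S.IsInternal x.2.1 ∧ ∃ e, T.Fits ltr x.1.1 x.2.1 e ∧
    x.2.2 = (some e, T.nextGoals x.1.2 e)}
  intTrans_spec := fun _ _ _ h => h.1
  init := {(none, ∅)}
  final := {q | q.2 = ∅}

theorem Tiling.mem_automaton_iff [Finite E] (T : Tiling E) (w : ℕ → A) :
    w ∈ (T.automaton S ltr).stringLanguage ↔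
      ∃ e : ℕ → E, ltr ∘ e = w ∧ T.Holds (S.kind ∘ ltr) e := by
  rw [BuchiMVPA.mem_stringLanguage_iff]
  constructor
  · rintro ⟨q, B, h0, hc, hm, hu, hi, hF⟩
    have hstep : ∀ i, ∃ e, T.Fits ltr (q i).1 (w i) e ∧
        q (i + 1) = (some e, T.nextGoals (q i).2 e) := by
      intro i
      match hk : S.kind (w i) with
      | .call s =>
        obtain ⟨-, e, h1, -, h2⟩ := hc i s hk
        exact ⟨e, h1, h2⟩
      | .ret s =>
        by_cases hp : pending (S.kind ∘ w) s i = []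
        · obtain ⟨-, e, h1, -, -, h2⟩ := hu i s hk hp
          exact ⟨e, h1, h2⟩
        · obtain ⟨p, hp⟩ := exists_matched_of_ret (κ := S.kind ∘ w) hk hp
          obtain ⟨-, e, h1, -, -, h2⟩ := hm p i s hp
          exact ⟨e, h1, h2⟩
      | .int =>
        obtain ⟨-, e, h1, h2⟩ := hi i hk
        exact ⟨e, h1, h2⟩
    choose e he hq using hstep
    have huniq : ∀ {i x G}, q (i + 1) = (some x, G) → e i = x := by
      intro i x G h
      rw [hq i] at h
      simpa using congrArg Prod.fst h
    have hw : ltr ∘ e = w := funext fun i => (he i).1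
    have hkw : (S.kind ∘ ltr) ∘ e = S.kind ∘ w := by rw [Function.comp_assoc, hw]
    have hgoals : ∀ i, (q i).2 = T.goals e i := by
      intro i
      induction i with
      | zero => rw [show q 0 = (none, ∅) from h0]; rfl
      | succ i ih => rw [hq i, Tiling.goals, ← ih]
    refine ⟨e, hw, fun i => (he i).2.1, ?_, ?_, ?_, ?_, ?_⟩
    · exact (he 0).2.2.1 (by rw [show q 0 = (none, ∅) from h0])
    · exact fun i => (he (i + 1)).2.2.2 _ (by rw [hq i])
    · intro s i j h
      rw [hkw] at h
      obtain ⟨-, x, -, hx, hx'⟩ := hc i s h.call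
      obtain ⟨-, y, -, -, hy, hy'⟩ := hm i j s h
      rw [huniq hy', huniq hx']
      exact hy x hx
    · intro s j hr hp
      rw [hkw] at hp
      obtain ⟨-, y, -, hy, -, hy'⟩ := hu j s (by rw [← hw]; exact hr) hp
      rw [huniq hy']
      exact hy rfl
    · rw [← T.goals_infinite_iff]
      have : {i | T.goals e i = ∅} = {i | q i ∈ (T.automaton S ltr).final} := by
        ext i
        change T.goals e i = ∅ ↔ (q i).2 = ∅
        rw [hgoals]
      rwa [this]
  · rintro ⟨e, rfl, h⟩
    let o : ℕ → Option E := fun i => match i with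
      | 0 => none
      | i + 1 => some (e i)
    have hfit : ∀ i, T.Fits ltr (o i) (ltr (e i)) (e i) := by
      intro i
      refine ⟨rfl, h.loc i, ?_, ?_⟩
      · match i with
        | 0 => exact fun _ => h.init
        | i + 1 => exact fun h => by simp [o] at h
      · match i with
        | 0 => exact fun _ h => by simp [o] at h
        | i + 1 =>
          intro e₀ h1
          simp only [o, Option.some.injEq] at h1
          subst h1
          exact h.step i
    refine ⟨fun i => (o i, T.goals e i), fun i => some (e i), rfl, ?_, ?_, ?_, ?_, ?_⟩
    · exact fun i s hs => ⟨⟨s, hs⟩, e i, hfit i, rfl, rfl⟩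
    · refine fun i j s hm => ⟨⟨s, hm.ret⟩, e j, hfit j, by simp, ?_, rfl⟩
      intro e₀ h1
      simp only [Option.some.injEq] at h1
      subst h1
      exact h.mat s i j hm
    · refine fun j s hs hp => ⟨⟨s, hs⟩, e j, hfit j, fun _ => h.unm s j hs hp, ?_, rfl⟩
      intro e₀ h1
      exact absurd h1 (by simp [Tiling.automaton])
    · exact fun i hs => ⟨hs, e i, hfit i, rfl⟩
    · exact (T.goals_infinite_iff e).2 h.acc

end Automaton

/-! ### Recognizable properties of labellings -/

/-- The property `P` of labellings by `C`, where `k` gives the kinds of the letters, is the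
projection of a tiling system. -/
def Recognizable {C : Type} (k : C → LetterKind K) (P : (ℕ → C) → Prop) : Prop :=
  ∃ (D : Type) (_ : Finite D) (T : Tiling (C × D)), ∀ c, P c ↔
    ∃ δ : ℕ → D, T.Holds (k ∘ Prod.fst) fun i => (c i, δ i)

namespace Recognizable

variable {C : Type} {k : C → LetterKind K}

theorem congr {P Q : (ℕ → C) → Prop} (h : Recognizable k P) (hPQ : ∀ c, P c ↔ Q c) :
    Recognizable k Q := by
  obtain rfl : P = Q := funext fun c => propext (hPQ c)
  exact h

theorem of_tiling (T : Tiling C) : Recognizable k (T.Holds k) :=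
  ⟨Unit, inferInstance, T.comap Prod.fst, fun _ =>
    ⟨fun h => ⟨fun _ => (), (T.holds_comap Prod.fst k _).2 h⟩,
      fun ⟨_, h⟩ => (T.holds_comap Prod.fst k _).1 h⟩⟩

theorem comap {C' : Type} {k' : C' → LetterKind K} (f : C → C') (hf : k' ∘ f = k)
    {P : (ℕ → C') → Prop} (h : Recognizable k' P) : Recognizable k fun c => P (f ∘ c) := by
  obtain ⟨D, hD, T, hT⟩ := h
  subst hf
  exact ⟨D, hD, T.comap (Prod.map f id), fun c => (hT _).trans
    (exists_congr fun δ => (T.holds_comap (Prod.map f id) (k' ∘ Prod.fst)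
      fun i => (c i, δ i)).symm)⟩

theorem all {ι : Type} [Finite ι] {P : ι → (ℕ → C) → Prop} (h : ∀ a, Recognizable k (P a)) :
    Recognizable k fun c => ∀ a, P a c := by
  choose D hD T hT using h
  refine ⟨∀ a, D a, inferInstance, .all fun a => (T a).comap (Prod.map id fun d => d a),
    fun c => ?_⟩
  simp only [hT, Tiling.holds_all]
  constructor
  · intro h
    choose δ h using h
    exact ⟨fun i a => δ a i, fun a => ((T a).holds_comap (Prod.map id fun d : ∀ a, D a => d a)
      (k ∘ Prod.fst) fun i => (c i, fun a => δ a i)).2 (h a)⟩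
  · rintro ⟨δ, h⟩ a
    exact ⟨fun i => δ i a, ((T a).holds_comap (Prod.map id fun d : ∀ a, D a => d a)
      (k ∘ Prod.fst) fun i => (c i, δ i)).1 (h a)⟩

theorem and {P Q : (ℕ → C) → Prop} (hP : Recognizable k P) (hQ : Recognizable k Q) :
    Recognizable k fun c => P c ∧ Q c :=
  (all (P := fun b : Bool => if b then P else Q) (by rintro (_ | _) <;> assumption)).congr
    fun c => by simp [and_comm]

theorem ex {D : Type} [Finite D] {P : (ℕ → C × D) → Prop}
    (h : Recognizable (k ∘ Prod.fst) P) :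
    Recognizable k fun c => ∃ δ : ℕ → D, P fun i => (c i, δ i) := by
  obtain ⟨D', hD', T, hT⟩ := h
  refine ⟨D × D', inferInstance, T.comap fun x => ((x.1, x.2.1), x.2.2), fun c => ?_⟩
  simp only [hT]
  constructor
  · rintro ⟨δ, δ', h⟩
    exact ⟨fun i => (δ i, δ' i), (T.holds_comap (fun x : C × D × D' => ((x.1, x.2.1), x.2.2))
      ((k ∘ Prod.fst) ∘ Prod.fst) _).2 h⟩
  · rintro ⟨δ, h⟩
    exact ⟨fun i => (δ i).1, fun i => (δ i).2,
      (T.holds_comap (fun x : C × D × D' => ((x.1, x.2.1), x.2.2))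
        ((k ∘ Prod.fst) ∘ Prod.fst) _).1 h⟩

theorem forall_letter (R : C → Prop) : Recognizable k fun c => ∀ i, R (c i) :=
  (of_tiling { Tiling.top C with loc := R }).congr fun _ =>
    ⟨fun h => h.loc, fun h => ⟨h, trivial, fun _ => trivial, fun _ _ _ _ => trivial,
      fun _ _ _ _ => trivial, fun a => a.elim⟩⟩

theorem init (R : C → Prop) : Recognizable k fun c => R (c 0) :=
  (of_tiling { Tiling.top C with init := R }).congr fun _ =>
    ⟨fun h => h.init, fun h => ⟨fun _ => trivial, h, fun _ => trivial, fun _ _ _ _ => trivial,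
      fun _ _ _ _ => trivial, fun a => a.elim⟩⟩

theorem step (R : C → C → Prop) : Recognizable k fun c => ∀ i, R (c i) (c (i + 1)) :=
  (of_tiling { Tiling.top C with step := R }).congr fun _ =>
    ⟨fun h => h.step, fun h => ⟨fun _ => trivial, trivial, h, fun _ _ _ _ => trivial,
      fun _ _ _ _ => trivial, fun a => a.elim⟩⟩

theorem matched (R : C → C → Prop) :
    Recognizable k fun c => ∀ s i j, Matched (k ∘ c) s i j → R (c i) (c j) :=
  (of_tiling { Tiling.top C with mat := R }).congr fun _ =>
    ⟨fun h => h.mat, fun h => ⟨fun _ => trivial, trivial, fun _ => trivial, h,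
      fun _ _ _ _ => trivial, fun a => a.elim⟩⟩

theorem unmatched_ret (R : C → Prop) : Recognizable k fun c =>
    ∀ s j, k (c j) = .ret s → pending (k ∘ c) s j = [] → R (c j) :=
  (of_tiling { Tiling.top C with unm := R }).congr fun _ =>
    ⟨fun h => h.unm, fun h => ⟨fun _ => trivial, trivial, fun _ => trivial,
      fun _ _ _ _ => trivial, h, fun a => a.elim⟩⟩

theorem infinite (R : C → Prop) : Recognizable k fun c => {i | R (c i)}.Infinite :=
  (of_tiling { Tiling.top C with
      Idx := Unit
      finite_idx := inferInstance
      acc := fun _ => R }).congr fun _ =>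
    ⟨fun h => h.acc (), fun h => ⟨fun _ => trivial, trivial, fun _ => trivial,
      fun _ _ _ _ => trivial, fun _ _ _ _ => trivial, fun _ => h⟩⟩

end Recognizable

/-! ### Unmatched calls -/

/-- A certificate that the calls of stack `s` that are not marked by `m` contain all unmatched ones.
Here `b i` and `b' i` say that no marked call is pending after, respectively before, position
`i`. -/
structure MarksMatched (κ : ℕ → LetterKind K) (s : Fin K) (m b b' : ℕ → Prop) : Prop where
  before_zero : b' 0
  before_succ : ∀ i, b' (i + 1) ↔ b i
  other : ∀ i, κ i ≠ .call s → κ i ≠ .ret s → (b i ↔ b' i)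
  call_marked : ∀ i, κ i = .call s → m i → ¬ b i
  call_unmarked : ∀ i, κ i = .call s → ¬ m i → b i ∧ b' i
  ret_matched : ∀ i j, Matched κ s i j → (b j ↔ b' i) ∧ m i
  ret_unmatched : ∀ j, κ j = .ret s → pending κ s j = [] → b j ∧ b' j
  recurrent : {i | b i}.Infinite

/-- Marking the matched calls is a certificate. Infinitely often no matched call is pending: the
lowest matched call that is pending will be popped at some time. -/
theorem marksMatched_matched (κ : ℕ → LetterKind K) (s : Fin K) :
    MarksMatched κ s (fun i => ∃ j, Matched κ s i j)
      (fun i => ∀ p ∈ pending κ s (i + 1), ∀ j, ¬ Matched κ s p j)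
      (fun i => ∀ p ∈ pending κ s i, ∀ j, ¬ Matched κ s p j) where
  before_zero := by simp [pending]
  before_succ _ := Iff.rfl
  other i h1 h2 := by rw [pending_succ_other h1 h2]
  call_marked i hi hm hb := by
    obtain ⟨j, hj⟩ := hm
    exact hb i (by simp [pending_succ_call hi]) j hj
  call_unmarked i hi hm := by
    have hu : ∀ j, ¬ Matched κ s i j := fun j hj => hm ⟨j, hj⟩
    have : ∀ p ∈ pending κ s i, ∀ j, ¬ Matched κ s p j := by
      intro p hp j hj
      have hpi := lt_of_mem_pending hp
      rcases Nat.lt_or_ge i j with h | h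
      · have := hj.le_of_mem (mem_pending_of_unmatched hi hu h)
        omega
      · rcases h.lt_or_eq with h | rfl
        · exact hj.not_mem_of_lt h hp
        · rw [hj.ret] at hi; simp at hi
    refine ⟨?_, this⟩
    rw [pending_succ_call hi]
    intro p hp
    rcases List.mem_cons.1 hp with rfl | hp
    · exact hu
    · exact this p hp
  ret_matched i j h := ⟨by rw [h.pending_succ], j, h⟩
  ret_unmatched j hj hp := by simp [pending_succ_ret hj, hp]
  recurrent := by
    rw [Set.infinite_iff_exists_gt]
    intro n
    by_cases hb : ∀ p ∈ pending κ s (n + 1 + 1), ∀ j, ¬ Matched κ s p j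
    · exact ⟨n + 1, hb, by omega⟩
    · push Not at hb
      classical
      have hex : ∃ p, p ∈ pending κ s (n + 1 + 1) ∧ ∃ j, Matched κ s p j := hb
      obtain ⟨hp, j, hj⟩ := Nat.find_spec hex
      have hnj : n + 1 < j + 1 := by
        by_contra hlt
        exact hj.not_mem_of_lt (m := n + 1 + 1) (by omega) hp
      refine ⟨j, ?_, by omega⟩
      change ∀ p ∈ pending κ s (j + 1), ∀ j, ¬ Matched κ s p j
      rw [hj.pending_succ]
      intro p hp' j' hj'
      have hlt := lt_of_mem_pending hp'
      refine Nat.find_min hex hlt ⟨?_, j', hj'⟩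
      -- `p` lies below the least matched call pending at `n + 2`, hence is pending there as well
      have hpj : p ∈ pending κ s j := by rw [hj.pending_eq]; exact List.mem_cons_of_mem _ hp'
      rcases Nat.lt_or_ge (n + 1 + 1) (j + 1) with h | h
      · exact mem_pending_of_mem hpj (by have := lt_of_mem_pending hp; omega) (by omega)
      · obtain rfl : j = n + 1 := by omega
        rw [hj.pending_succ]
        exact hp'

theorem MarksMatched.not_mark_of_unmatched {κ : ℕ → LetterKind K} {s : Fin K} {m b b' : ℕ → Prop}
    (h : MarksMatched κ s m b b') {i : ℕ} (hi : κ i = .call s) (hu : ∀ j, ¬ Matched κ s i j) :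
    ¬ m i := by
  intro hm
  -- the marked call `i` stays pending for ever, so `b` fails from position `i` on
  have key : ∀ n, i ≤ n → ¬ b n := by
    intro n
    induction n using Nat.strong_induction_on with
    | _ n ih =>
      intro hn hb
      rcases hn.lt_or_eq with hlt | rfl
      · obtain ⟨n, rfl⟩ : ∃ n', n = n' + 1 := ⟨n - 1, by omega⟩
        have hprev : ¬ b' (n + 1) := by
          rw [h.before_succ]
          exact ih n (by omega) (by omega)
        by_cases hc : κ (n + 1) = .call s
        · by_cases hmn : m (n + 1)
          · exact h.call_marked _ hc hmn hb
          · exact hprev (h.call_unmarked _ hc hmn).2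
        by_cases hr : κ (n + 1) = .ret s
        · have hmem := mem_pending_of_unmatched hi hu hlt
          obtain ⟨p, hp⟩ := exists_matched_of_ret hr (List.ne_nil_of_mem hmem)
          have hip := hp.le_of_mem hmem
          have hne : i ≠ p := by rintro rfl; exact hu _ hp
          have hpn := hp.lt
          obtain ⟨p, rfl⟩ : ∃ p', p = p' + 1 := ⟨p - 1, by omega⟩
          have := (h.ret_matched _ _ hp).1.1 hb
          rw [h.before_succ] at this
          exact ih p (by omega) (by omega) this
        · exact hprev ((h.other _ hc hr).1 hb)
      · exact h.call_marked _ hi hm hb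
  obtain ⟨n, hn, hin⟩ := (Set.infinite_iff_exists_gt.1 h.recurrent) i
  exact key n hin.le hn

/-- A local condition can be imposed on the unmatched calls, although no automaton notices that a
call is never popped: it is enough to guess which calls are matched. -/
theorem Recognizable.unmatched_call {C : Type} {k : C → LetterKind K} (s : Fin K) (R : C → Prop) :
    Recognizable k fun c =>
      ∀ i, k (c i) = .call s → (∀ j, ¬ Matched (k ∘ c) s i j) → R (c i) := by
  -- the labels are `m`, `b`, `b'`
  let kk : C × Prop × Prop × Prop → LetterKind K := k ∘ Prod.fst
  have h := ((((((((Recognizable.init (k := kk) fun x => x.2.2.2).and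
    (.step fun x y => y.2.2.2 ↔ x.2.2.1)).and
    (.forall_letter fun x => kk x ≠ .call s → kk x ≠ .ret s → (x.2.2.1 ↔ x.2.2.2))).and
    (.forall_letter fun x => kk x = .call s → x.2.1 → ¬ x.2.2.1)).and
    (.forall_letter fun x => kk x = .call s → ¬ x.2.1 → x.2.2.1 ∧ x.2.2.2 ∧ R x.1)).and
    (.matched fun x y => kk y = .ret s → (y.2.2.1 ↔ x.2.2.2) ∧ x.2.1)).and
    (.unmatched_ret fun x => kk x = .ret s → x.2.2.1 ∧ x.2.2.2)).and
    (.infinite fun x => x.2.2.1)).ex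
  refine h.congr fun c => ?_
  constructor
  · rintro ⟨δ, ⟨⟨⟨⟨⟨⟨⟨h1, h2⟩, h3⟩, h4⟩, h5⟩, h6⟩, h7⟩, h8⟩⟩ i hi hu
    have hM : MarksMatched (k ∘ c) s (fun i => (δ i).1) (fun i => (δ i).2.1)
        (fun i => (δ i).2.2) :=
      ⟨h1, h2, h3, h4, fun i hi hm => ⟨(h5 i hi hm).1, (h5 i hi hm).2.1⟩,
        fun i j hm => h6 s i j hm hm.ret, fun j hj hp => h7 s j hj hp hj, h8⟩
    exact (h5 i hi (hM.not_mark_of_unmatched hi hu)).2.2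
  · intro hR
    obtain ⟨m, b, b', hM, hmark⟩ : ∃ m b b', MarksMatched (k ∘ c) s m b b' ∧
        ∀ i, m i ↔ ∃ j, Matched (k ∘ c) s i j :=
      ⟨_, _, _, marksMatched_matched (k ∘ c) s, fun _ => Iff.rfl⟩
    refine ⟨fun i => (m i, b i, b' i), ⟨⟨⟨⟨⟨⟨⟨hM.before_zero, hM.before_succ⟩, hM.other⟩,
      hM.call_marked⟩, fun i hi h => ⟨(hM.call_unmarked i hi h).1,
        (hM.call_unmarked i hi h).2, hR i hi fun j hj => h ((hmark i).2 ⟨j, hj⟩)⟩⟩,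
        ?_⟩, ?_⟩, hM.recurrent⟩⟩
    · intro t i j hm hj
      obtain rfl : t = s := by
        have := hm.ret.symm.trans hj
        simpa using this
      exact hM.ret_matched i j hm
    · intro t j hj hp hj'
      obtain rfl : t = s := by
        have := hj.symm.trans hj'
        simpa using this
      exact hM.ret_unmatched j hj hp

/-! ### Moves and walks -/

/-- The moves that lead from a position to a neighbouring one: to the successor, to the predecessor,
and along a matching edge. -/
inductive Move : Type
  | succ
  | pred
  | arc

namespace Move

/-- The move in the opposite direction. -/
def inv : Move → Move
  | succ => pred
  | pred => succ
  | arc => arc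

@[simp] theorem inv_inv (d : Move) : d.inv.inv = d := by cases d <;> rfl

instance : Finite Move :=
  Finite.of_injective (β := Fin 3) (fun d => match d with | succ => 0 | pred => 1 | arc => 2)
    (by rintro (_ | _ | _) (_ | _ | _) h <;> simp_all)

end Move

/-- The positions `i` and `j` are joined by a matching edge. -/
def Partner (κ : ℕ → LetterKind K) (i j : ℕ) : Prop :=
  ∃ s, Matched κ s i j ∨ Matched κ s j i

theorem Partner.symm {κ : ℕ → LetterKind K} {i j : ℕ} (h : Partner κ i j) : Partner κ j i := by
  obtain ⟨s, h⟩ := h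
  exact ⟨s, h.symm⟩

theorem Partner.unique {κ : ℕ → LetterKind K} {i j j' : ℕ} (h : Partner κ i j)
    (h' : Partner κ i j') : j = j' := by
  obtain ⟨s, h | h⟩ := h <;> obtain ⟨t, h' | h'⟩ := h'
  · obtain rfl : s = t := by simpa using h.call.symm.trans h'.call
    exact h.right_unique h'
  · simpa using h.call.symm.trans h'.ret
  · simpa using h.ret.symm.trans h'.call
  · obtain rfl : s = t := by simpa using h.ret.symm.trans h'.ret
    exact h.left_unique h'

open Classical in
/-- The position reached from position `i` by a move, if there is one. -/
noncomputable def mv (κ : ℕ → LetterKind K) : Move → ℕ → Option ℕ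
  | .succ, i => some (i + 1)
  | .pred, 0 => none
  | .pred, i + 1 => some i
  | .arc, i => if h : ∃ j, Partner κ i j then some h.choose else none

section Walks

variable {κ : ℕ → LetterKind K} {d : Move} {i j : ℕ}

theorem mv_succ : mv κ .succ i = some j ↔ j = i + 1 := by
  simp [mv, eq_comm]

theorem mv_pred : mv κ .pred i = some j ↔ i = j + 1 := by
  cases i <;> simp [mv]

theorem mv_arc : mv κ .arc i = some j ↔ Partner κ i j := by
  simp only [mv]
  split_ifs with h
  · simp only [Option.some.injEq]
    constructor
    · rintro rfl; exact h.choose_spec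
    · exact fun h' => h.choose_spec.unique h'
  · simp only [false_iff]
    exact fun h' => h ⟨j, h'⟩

theorem mv_inv : mv κ d.inv j = some i ↔ mv κ d i = some j := by
  cases d
  · exact mv_pred.trans mv_succ.symm
  · exact mv_succ.trans mv_pred.symm
  · exact mv_arc.trans ((Iff.intro Partner.symm Partner.symm).trans mv_arc.symm)

theorem mv_ne (h : mv κ d i = some j) : i ≠ j := by
  cases d
  · rw [mv_succ] at h; omega
  · rw [mv_pred] at h; omega
  · rw [mv_arc] at h
    obtain ⟨s, h | h⟩ := h <;> have := h.lt <;> omega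

/-- The position reached from position `i` by a sequence of moves. -/
noncomputable def walk (κ : ℕ → LetterKind K) : List Move → ℕ → Option ℕ
  | [], i => some i
  | d :: u, i => (mv κ d i).bind (walk κ u)

@[simp] theorem walk_nil : walk κ [] i = some i := rfl

theorem walk_cons (d : Move) (u : List Move) (i : ℕ) :
    walk κ (d :: u) i = (mv κ d i).bind (walk κ u) := rfl

@[simp] theorem walk_singleton : walk κ [d] i = mv κ d i := by
  rw [walk_cons]
  cases mv κ d i <;> rfl

theorem walk_append (u v : List Move) (i : ℕ) :
    walk κ (u ++ v) i = (walk κ u i).bind (walk κ v) := by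
  induction u generalizing i with
  | nil => rfl
  | cons d u ih =>
    rw [List.cons_append, walk_cons, walk_cons]
    cases mv κ d i with
    | none => rfl
    | some j => exact ih j

theorem walk_append_of_eq {u : List Move} (h : walk κ u i = some j) (v : List Move) :
    walk κ (u ++ v) i = walk κ v j := by
  rw [walk_append, h]; rfl

/-- The sequence of moves leading back. -/
def invWord (u : List Move) : List Move := (u.map Move.inv).reverse

@[simp] theorem length_invWord (u : List Move) : (invWord u).length = u.length := by
  simp [invWord]

@[simp] theorem invWord_invWord (u : List Move) : invWord (invWord u) = u := by
  simp [invWord, Function.comp_def]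

theorem walk_invWord_of {u : List Move} (h : walk κ u i = some j) :
    walk κ (invWord u) j = some i := by
  induction u generalizing i with
  | nil => simp_all [invWord]
  | cons d u ih =>
    rw [walk_cons] at h
    obtain ⟨l, hl, h⟩ := Option.bind_eq_some_iff.1 h
    rw [invWord, List.map_cons, List.reverse_cons, ← invWord, walk_append_of_eq (ih h),
      walk_singleton, mv_inv]
    exact hl

theorem walk_invWord {u : List Move} : walk κ (invWord u) j = some i ↔ walk κ u i = some j :=
  ⟨fun h => by simpa using walk_invWord_of h, walk_invWord_of⟩

theorem walk_injective {u : List Move} {i' : ℕ} (h : walk κ u i = some j)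
    (h' : walk κ u i' = some j) : i = i' := by
  have := (walk_invWord_of h).symm.trans (walk_invWord_of h')
  simpa using this

end Walks

/-! ### The turning number of a walk -/

/-- With the matching edges of stack `0` drawn above the line of positions and those of stack `1`
below it, an infinite nested word becomes a plane graph. This is the number of half turns,
counterclockwise, that a secant makes when one of its ends moves along the matching edge leaving a
position of the given kind and thereby passes over or below its other end. -/
def halfTurn : LetterKind 2 → ℤ
  | .call s => if s = 0 then -1 else 1
  | .ret s => if s = 0 then 1 else -1
  | .int => 0

open Classical in
/-- The half turns that the secant between `x` and a point moving along an edge from `b` to `c`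
makes. -/
noncomputable def swing (κ : ℕ → LetterKind 2) (x b c : ℕ) : ℤ :=
  if Partner κ b c ∧ (b < x ∧ x < c ∨ c < x ∧ x < b) then halfTurn (κ b) else 0

/-- The turn, in half turns of the secant, between two consecutive edges whose three ends are
distinct (see `turn_eq_swing`). It depends only on the two moves and on the kind of the letter
between them. -/
def turn : Move → LetterKind 2 → Move → ℤ
  | .succ, .ret s, .arc => halfTurn (.ret s)
  | .pred, .call s, .arc => halfTurn (.call s)
  | .arc, .call s, .succ => - halfTurn (.call s)
  | .arc, .ret s, .pred => - halfTurn (.ret s)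
  | _, _, _ => 0

section Planarity

variable {κ : ℕ → LetterKind 2}

theorem halfTurn_ret (s : Fin 2) : halfTurn (.ret s) = - halfTurn (.call s) := by
  simp only [halfTurn]; split_ifs <;> simp

theorem swing_of_adjacent {x b c : ℕ} (h : b = c + 1 ∨ c = b + 1) : swing κ x b c = 0 := by
  unfold swing
  rw [if_neg]
  omega

theorem swing_of_le {x b c : ℕ} (h : x ≤ b) (h' : x ≤ c) : swing κ x b c = 0 := by
  unfold swing
  rw [if_neg]
  omega

theorem swing_of_ge {x b c : ℕ} (h : b ≤ x) (h' : c ≤ x) : swing κ x b c = 0 := by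
  unfold swing
  rw [if_neg]
  omega

theorem swing_call {x b c : ℕ} {s : Fin 2} (h : Matched κ s b c) :
    swing κ x b c = if b < x ∧ x < c then halfTurn (.call s) else 0 := by
  have hp : Partner κ b c := ⟨s, .inl h⟩
  have := h.lt
  rw [swing, h.call]
  congr 1
  simp only [hp, true_and, eq_iff_iff]
  omega

theorem swing_ret {x b c : ℕ} {s : Fin 2} (h : Matched κ s c b) :
    swing κ x b c = if c < x ∧ x < b then - halfTurn (.call s) else 0 := by
  have hp : Partner κ b c := ⟨s, .inr h⟩
  have := h.lt
  rw [swing, h.ret, halfTurn_ret]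
  congr 1
  simp only [hp, true_and, eq_iff_iff]
  omega

theorem swing_neg (x b c : ℕ) : swing κ x c b = - swing κ x b c := by
  by_cases hp : Partner κ b c
  · obtain ⟨s, h | h⟩ := hp
    · rw [swing_call h, swing_ret h]; split_ifs <;> simp
    · rw [swing_call h, swing_ret h]; split_ifs <;> simp
  · rw [swing, swing, if_neg, if_neg, neg_zero]
    · exact fun h => hp h.1
    · exact fun h => hp h.1.symm

/-- Two disjoint edges do not cross: the secant between a point of one and a point of the other has
the same total swing whichever of its ends is moved first. -/
theorem swing_square {a b c d : ℕ} {p q : Move} (hab : mv κ p a = some b)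
    (hcd : mv κ q c = some d) (hac : a ≠ c) (had : a ≠ d) (hbc : b ≠ c) (hbd : b ≠ d) :
    swing κ a c d + swing κ d a b = swing κ c a b + swing κ b c d := by
  -- the claim for edges `a → b` and `c → d` that are both matching edges leading to the right
  have key : ∀ {a b c d : ℕ} {s t : Fin 2}, Matched κ s a b → Matched κ t c d → a ≠ c → a ≠ d →
      b ≠ c → b ≠ d → swing κ a c d + swing κ d a b = swing κ c a b + swing κ b c d := by
    intro a b c d s t h h' h1 h2 h3 h4
    have hl := h.lt
    have hl' := h'.lt
    rw [swing_call h, swing_call h, swing_call h', swing_call h']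
    by_cases hst : s = t
    · subst hst
      have n1 : ¬ (a < c ∧ c < b ∧ b < d) := fun ⟨x, y, z⟩ => h.noncrossing h' x y z
      have n2 : ¬ (c < a ∧ a < d ∧ d < b) := fun ⟨x, y, z⟩ => h'.noncrossing h x y z
      split_ifs <;> omega
    · have hε : halfTurn (.call t) = - halfTurn (.call s) := by
        fin_cases s <;> fin_cases t <;> simp_all [halfTurn]
      rw [hε]
      split_ifs <;> omega
  have adj : ∀ {a b c d : ℕ} {q : Move}, (a = b + 1 ∨ b = a + 1) → mv κ q c = some d → a ≠ c →
      a ≠ d → b ≠ c → b ≠ d →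
      swing κ a c d + swing κ d a b = swing κ c a b + swing κ b c d := by
    intro a b c d q hadj hcd h1 h2 h3 h4
    rw [swing_of_adjacent hadj, swing_of_adjacent hadj, add_zero, zero_add]
    unfold swing
    congr 1
    simp only [eq_iff_iff, and_congr_right_iff]
    intro _
    omega
  cases p
  · exact adj (.inr (mv_succ.1 hab)) hcd hac had hbc hbd
  · exact adj (.inl (mv_pred.1 hab)) hcd hac had hbc hbd
  have hq : (c = d + 1 ∨ d = c + 1) →
      swing κ a c d + swing κ d a b = swing κ c a b + swing κ b c d := by
    intro h
    have := adj (a := c) (b := d) (c := a) (d := b) h hab hac.symm hbc.symm had.symm hbd.symm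
    omega
  cases q
  · exact hq (.inr (mv_succ.1 hcd))
  · exact hq (.inl (mv_pred.1 hcd))
  obtain ⟨s, h⟩ := mv_arc.1 hab
  obtain ⟨t, h'⟩ := mv_arc.1 hcd
  rcases h with h | h <;> rcases h' with h' | h'
  · exact key h h' hac had hbc hbd
  · have := key h h' had hac hbd hbc
    rw [swing_neg a c d, swing_neg b c d] at this
    omega
  · have := key h h' hbc hbd hac had
    rw [swing_neg c a b, swing_neg d a b] at this
    omega
  · have := key h h' hbd hbc had hac
    rw [swing_neg c a b, swing_neg d a b, swing_neg a c d, swing_neg b c d] at this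
    omega

theorem turn_eq_swing {a b c : ℕ} {p q : Move} (hab : mv κ p a = some b)
    (hbc : mv κ q b = some c) (hac : a ≠ c) :
    turn p (κ b) q = swing κ a b c + swing κ c a b := by
  cases p <;> cases q
  · rw [mv_succ] at hab hbc
    rw [swing_of_adjacent (.inr hbc), swing_of_adjacent (.inr hab)]
    cases κ b <;> rfl
  · rw [mv_succ] at hab
    rw [mv_pred] at hbc
    omega
  · rw [mv_succ] at hab
    rw [mv_arc] at hbc
    obtain ⟨s, h | h⟩ := hbc <;> have := h.lt
    · rw [swing_of_adjacent (.inr hab), swing_of_le (by omega) (by omega), h.call]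
      rfl
    · rw [swing_of_adjacent (.inr hab), swing_ret h, if_pos (by omega), h.ret, add_zero,
        ← halfTurn_ret]
      rfl
  · rw [mv_succ] at hbc
    rw [mv_pred] at hab
    omega
  · rw [mv_pred] at hab hbc
    rw [swing_of_adjacent (.inl hbc), swing_of_adjacent (.inl hab)]
    cases κ b <;> rfl
  · rw [mv_pred] at hab
    rw [mv_arc] at hbc
    obtain ⟨s, h | h⟩ := hbc <;> have := h.lt
    · rw [swing_of_adjacent (.inl hab), swing_call h, if_pos (by omega), h.call, add_zero]
      rfl
    · rw [swing_of_adjacent (.inl hab), swing_of_ge (by omega) (by omega), h.ret]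
      rfl
  · rw [mv_succ] at hbc
    rw [mv_arc] at hab
    obtain ⟨s, h | h⟩ := hab <;> have := h.lt
    · rw [swing_of_adjacent (.inr hbc), swing_of_ge (by omega) (by omega), h.ret]
      rfl
    · rw [swing_of_adjacent (.inr hbc), swing_ret h, if_pos (by omega), h.call, zero_add]
      rfl
  · rw [mv_pred] at hbc
    rw [mv_arc] at hab
    obtain ⟨s, h | h⟩ := hab <;> have := h.lt
    · rw [swing_of_adjacent (.inl hbc), swing_call h, if_pos (by omega), h.ret, zero_add]
      simp [turn, halfTurn_ret]
    · rw [swing_of_adjacent (.inl hbc), swing_of_le (by omega) (by omega), h.call]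
      rfl
  · rw [mv_arc] at hab hbc
    exact absurd (hab.symm.unique hbc) hac

end Planarity

/-! ### Simple walks and their total turning -/

section Turning

variable {κ : ℕ → LetterKind 2} {D : ℕ → Move} {v : ℕ → ℕ}

/-- The comparison of the secants from `v s` and from `v (s + 1)` to the points of a simple walk. -/
theorem turn_add_sum_swing (hv : ∀ a, mv κ (D a) (v a) = some (v (a + 1))) {s t : ℕ}
    (hst : s + 2 ≤ t) (hinj : ∀ a b, s ≤ a → a < b → b ≤ t → v a ≠ v b) :
    turn (D s) (κ (v (s + 1))) (D (s + 1)) +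
        ∑ b ∈ Finset.Ico (s + 2) t, swing κ (v (s + 1)) (v b) (v (b + 1)) =
      swing κ (v t) (v s) (v (s + 1)) +
        ∑ b ∈ Finset.Ico (s + 1) t, swing κ (v s) (v b) (v (b + 1)) := by
  induction t, hst using Nat.le_induction with
  | base =>
    rw [turn_eq_swing (hv s) (hv (s + 1)) (hinj _ _ le_rfl (by omega) le_rfl)]
    simp [add_comm, show 1 + (s + 1) = s + 2 by omega]
  | succ t hst ih =>
    have ih := ih fun a b h1 h2 h3 => hinj a b h1 h2 (by omega)
    have hsq := swing_square (hv s) (hv t) (hinj _ _ le_rfl (by omega) (by omega))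
      (hinj _ _ le_rfl (by omega) le_rfl)
      (hinj (s + 1) t (by omega) (by omega) (by omega))
      (hinj (s + 1) (t + 1) (by omega) (by omega) le_rfl)
    rw [Finset.sum_Ico_succ_top (by omega), Finset.sum_Ico_succ_top (by omega)]
    linarith

/-- Hopf's formula: the total turning of a simple walk is the total swing of the secant whose ends
run apart, first its end point and then its starting point. -/
theorem sum_turn_eq (hv : ∀ a, mv κ (D a) (v a) = some (v (a + 1))) {a b m : ℕ}
    (hab : a + 1 + m = b) (hinj : ∀ x y, a ≤ x → x < y → y ≤ b → v x ≠ v y) :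
    ∑ s ∈ Finset.Ico a (a + m), turn (D s) (κ (v (s + 1))) (D (s + 1)) =
      ∑ s ∈ Finset.Ico a (a + m), swing κ (v b) (v s) (v (s + 1)) +
      ∑ t ∈ Finset.Ico (a + 1) b, swing κ (v a) (v t) (v (t + 1)) := by
  induction m generalizing a with
  | zero => subst hab; simp
  | succ m ih =>
    have ih := ih (a := a + 1) (by omega) fun x y h => hinj x y (by omega)
    have h := turn_add_sum_swing hv (s := a) (t := b) (by omega) hinj
    rw [show a + 1 + m = a + (m + 1) by omega, show a + 1 + 1 = a + 2 by omega] at ih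
    rw [Finset.sum_eq_sum_Ico_succ_bot (by omega),
      Finset.sum_eq_sum_Ico_succ_bot (a := a) (by omega)]
    linarith

/-- A simple walk from its leftmost to its rightmost position has total turning zero. -/
theorem sum_turn_eq_zero (hv : ∀ a, mv κ (D a) (v a) = some (v (a + 1))) {m : ℕ}
    (hinj : ∀ x y, x < y → y ≤ m + 1 → v x ≠ v y) (hmin : ∀ x, v 0 ≤ v x)
    (hmax : ∀ x ≤ m + 1, v x ≤ v (m + 1)) :
    ∑ s ∈ Finset.range m, turn (D s) (κ (v (s + 1))) (D (s + 1)) = 0 := by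
  have h := sum_turn_eq hv (a := 0) (b := m + 1) (m := m) (by omega) fun x y _ => hinj x y
  rw [Finset.sum_eq_zero (s := Finset.Ico (0 + 1) (m + 1)), add_zero,
    Finset.sum_eq_zero (f := fun s => swing κ (v (m + 1)) (v s) (v (s + 1)))] at h
  · simpa using h
  · intro s hs
    have := Finset.mem_Ico.1 hs
    exact swing_of_ge (hmax _ (by omega)) (hmax _ (by omega))
  · intro s _
    exact swing_of_le (hmin _) (hmin _)

/-- The Umlaufsatz: a simple closed walk, started at its leftmost position, turns once around. -/
theorem sum_turn_closed (hv : ∀ a, mv κ (D a) (v a) = some (v (a + 1))) {N : ℕ} (hN : 3 ≤ N)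
    (hper : ∀ a, v (a + N) = v a) (hD : ∀ a, D (a + N) = D a)
    (hinj : ∀ x y, x < y → y < x + N → v x ≠ v y) (hmin : ∀ x, v 0 ≤ v x) :
    ∑ s ∈ Finset.range N, turn (D s) (κ (v (s + 1))) (D (s + 1)) = 2 ∨
      ∑ s ∈ Finset.range N, turn (D s) (κ (v (s + 1))) (D (s + 1)) = -2 := by
  obtain ⟨m, rfl⟩ : ∃ m, N = m + 2 := ⟨N - 2, by omega⟩
  have hv0 : v (m + 2) = v 0 := by simpa using hper 0
  have hv1 : v (m + 2 + 1) = v 1 := by rw [show m + 2 + 1 = 1 + (m + 2) by omega]; exact hper 1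
  have h1 := sum_turn_eq hv (a := 1) (b := m + 2) (m := m) (by omega)
    fun x y _ h h' => hinj x y h (by omega)
  rw [Finset.sum_eq_zero (f := fun s => swing κ (v (m + 2)) (v s) (v (s + 1)))
    (fun s _ => by rw [hv0]; exact swing_of_le (hmin _) (hmin _)), zero_add,
    Finset.sum_Ico_succ_top (by omega), show 1 + m = m + 1 by omega] at h1
  have h2 := turn_add_sum_swing hv (s := 0) (t := m + 1) (by omega)
    fun x y _ h h' => hinj x y h (by omega)
  rw [Finset.sum_eq_zero (f := fun b => swing κ (v 0) (v b) (v (b + 1)))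
    (fun s _ => swing_of_le (hmin _) (hmin _)), add_zero] at h2
  have hne : v (m + 1) ≠ v 1 := (hinj _ _ (by omega) (by omega)).symm
  have h3 := turn_eq_swing (hv (m + 1)) (hv (m + 2)) (by rw [hv1]; exact hne)
  rw [hv0, hv1] at h3
  have htot : ∑ s ∈ Finset.range (m + 2), turn (D s) (κ (v (s + 1))) (D (s + 1)) =
      2 * (swing κ (v (m + 1)) (v 0) (v 1) + swing κ (v 1) (v (m + 1)) (v 0)) := by
    rw [Finset.sum_range_succ, Finset.range_eq_Ico, Finset.sum_eq_sum_Ico_succ_bot (by omega)]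
    simp only [zero_add, Nat.reduceAdd, show m + 1 + 1 = m + 2 by omega] at h1 h2 h3 ⊢
    rw [hv0] at h1 ⊢
    rw [h1, h3]
    linarith
  rw [htot]
  -- one of the two edges at the leftmost position leads to its successor, which is passed by the
  -- other one
  have hm1 : v 0 ≠ v 1 := hinj _ _ (by omega) (by omega)
  have hm2 : v 0 ≠ v (m + 1) := hinj _ _ (by omega) (by omega)
  have hl1 := hmin 1
  have hl2 := hmin (m + 1)
  have e1 : mv κ (D 0) (v 0) = some (v 1) := hv 0
  have e2 := hv (m + 1)
  rw [show m + 1 + 1 = m + 2 by omega, hv0] at e2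
  have hcase : swing κ (v (m + 1)) (v 0) (v 1) + swing κ (v 1) (v (m + 1)) (v 0) = 1 ∨
      swing κ (v (m + 1)) (v 0) (v 1) + swing κ (v 1) (v (m + 1)) (v 0) = -1 := by
    have hpm : ∀ s : Fin 2, halfTurn (.call s) = 1 ∨ halfTurn (.call s) = -1 := by
      intro s; fin_cases s <;> simp [halfTurn]
    have right : ∀ {d x}, mv κ d (v 0) = some x → v 0 < x →
        x = v 0 + 1 ∨ ∃ s, Matched κ s (v 0) x := by
      intro d x hd hx
      cases d
      · exact .inl (mv_succ.1 hd)
      · have := mv_pred.1 hd; omega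
      · obtain ⟨s, h | h⟩ := mv_arc.1 hd
        · exact .inr ⟨s, h⟩
        · have := h.lt; omega
    rcases right e1 (by omega) with h | ⟨s, h⟩ <;>
      rcases right (mv_inv.2 e2) (by omega) with h' | ⟨t, h'⟩
    · exact absurd (h'.trans h.symm) hne
    · rw [swing_of_adjacent (.inr h), swing_ret h', if_pos (by omega)]
      have := hpm t
      omega
    · rw [swing_of_adjacent (.inl h'), swing_call h, if_pos (by omega)]
      have := hpm s
      omega
    · exact absurd (Partner.unique ⟨t, .inl h'⟩ ⟨s, .inl h⟩) hne
  omega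

end Turning

section Periodic

variable {f : ℕ → ℤ} {n : ℕ}

theorem sum_range_shift_of_periodic (hf : ∀ a, f (a + n) = f a) (p : ℕ) :
    ∑ a ∈ Finset.range n, f (p + a) = ∑ a ∈ Finset.range n, f a := by
  induction p with
  | zero => simp
  | succ p ih =>
    have h1 := Finset.sum_range_succ (fun a => f (p + a)) n
    have h2 := Finset.sum_range_succ' (fun a => f (p + a)) n
    have h3 := hf p
    have : ∑ a ∈ Finset.range n, f (p + 1 + a) = ∑ a ∈ Finset.range n, f (p + (a + 1)) :=
      Finset.sum_congr rfl fun a _ => by rw [show p + 1 + a = p + (a + 1) by omega]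
    rw [add_zero] at h2
    linarith

theorem sum_range_mul_of_periodic (hf : ∀ a, f (a + n) = f a) (q : ℕ) :
    ∑ a ∈ Finset.range (n * q), f a = q * ∑ a ∈ Finset.range n, f a := by
  induction q with
  | zero => simp
  | succ q ih =>
    rw [Nat.mul_succ, Finset.sum_range_add, ih, sum_range_shift_of_periodic hf]
    push_cast
    ring

theorem eventually_sum_range_ne_zero_of_periodic (hn : 0 < n) (hf : ∀ a, f (a + n) = f a)
    (hσ : ∑ a ∈ Finset.range n, f a ≠ 0) :
    ∃ m₀, ∀ m ≥ m₀, ∑ a ∈ Finset.range m, f a ≠ 0 := by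
  obtain ⟨B, hB⟩ : ∃ B : ℕ, ∀ r < n, |∑ a ∈ Finset.range r, f a| ≤ B := by
    obtain ⟨B, hB⟩ := ((Finset.range n).image fun r => |∑ a ∈ Finset.range r, f a|).bddAbove
    refine ⟨B.toNat, fun r hr => ?_⟩
    have := hB (Finset.mem_coe.2 (Finset.mem_image_of_mem
      (fun r => |∑ a ∈ Finset.range r, f a|) (Finset.mem_range.2 hr)))
    exact this.trans (Int.self_le_toNat B)
  refine ⟨n * (B + 1), fun m hm h0 => ?_⟩
  have hq : B + 1 ≤ m / n := (Nat.le_div_iff_mul_le hn).2 (by rwa [mul_comm])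
  have hper : ∀ q a, f (n * q + a) = f a := by
    intro q a
    induction q with
    | zero => simp
    | succ q ih =>
      rw [← ih, ← hf (n * q + a)]
      congr 1
      ring
  have h1 : ∑ a ∈ Finset.range m, f a = ((m / n : ℕ) : ℤ) * ∑ a ∈ Finset.range n, f a +
      ∑ a ∈ Finset.range (m % n), f a := by
    conv_lhs => rw [← Nat.div_add_mod m n]
    rw [Finset.sum_range_add, sum_range_mul_of_periodic hf]
    congr 1
    exact Finset.sum_congr rfl fun a _ => hper _ a
  have h2 := hB (m % n) (Nat.mod_lt _ hn)
  rw [h0] at h1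
  have h3 : |((m / n : ℕ) : ℤ) * ∑ a ∈ Finset.range n, f a| ≤ B := by
    rw [show ((m / n : ℕ) : ℤ) * ∑ a ∈ Finset.range n, f a =
      -∑ a ∈ Finset.range (m % n), f a by linarith, abs_neg]
    exact h2
  rw [abs_mul, Nat.abs_cast] at h3
  have h4 : 1 ≤ |∑ a ∈ Finset.range n, f a| := Int.one_le_abs hσ
  have h5 : ((B + 1 : ℕ) : ℤ) ≤ ((m / n : ℕ) : ℤ) := by exact_mod_cast hq
  push_cast at h5 h3
  nlinarith

end Periodic

theorem exists_forall_le (v : ℕ → ℕ) (a : ℕ) : ∃ p ≥ a, ∀ x ≥ a, v p ≤ v x := by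
  obtain ⟨p, hp, h⟩ := WellFounded.has_min (InvImage.wf v Nat.lt_wfRel.wf) (Set.Ici a)
    Set.nonempty_Ici
  exact ⟨p, hp, fun x hx => not_lt.1 (h x hx)⟩

theorem exists_record {v : ℕ → ℕ} (hv : Function.Injective v) (m : ℕ) :
    ∃ b ≥ m, ∀ a ≤ b, v a ≤ v b := by
  classical
  have hex : ∃ b, ∀ a ≤ m, v a < v b := by
    obtain ⟨B, hB⟩ := ((Finset.range (m + 1)).image v).bddAbove
    obtain ⟨y, ⟨b, rfl⟩, hb⟩ := (Set.infinite_range_of_injective hv).exists_gt B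
    refine ⟨b, fun a ha => lt_of_le_of_lt (hB ?_) hb⟩
    exact Finset.mem_coe.2 (Finset.mem_image_of_mem v (Finset.mem_range.2 (by omega)))
  have hb := Nat.find_spec hex
  refine ⟨Nat.find hex, ?_, fun a ha => ?_⟩
  · by_contra h
    exact lt_irrefl _ (hb _ (not_le.1 h).le)
  · rcases ha.lt_or_eq with ha | ha
    · have := Nat.find_min hex ha
      push Not at this
      obtain ⟨x, hx, hx'⟩ := this
      exact hx'.trans (hb x hx).le
    · rw [ha]

/-- No plane graph of an infinite nested word over two stacks contains a proper covering of a cycle,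
finite or infinite. Suppose that a periodic sequence of moves describes a simple closed walk `y` in
one nested word and, in another one, a walk `v` that passes letters of the same kinds and meets
itself only at corresponding points. Then `v` is closed after one period as well: the turning
numbers of `y` and of a simple closed walk made of `m` copies would be `±2` and `± 2 m`, and a
simple infinite walk cannot keep on turning in one direction. -/
theorem closed_of_closed {κ κ' : ℕ → LetterKind 2} {D : ℕ → Move} {y v : ℕ → ℕ} {n : ℕ}
    (hn : 3 ≤ n) (hD : ∀ a, D (a + n) = D a)
    (hy : ∀ a, mv κ' (D a) (y a) = some (y (a + 1))) (hyper : ∀ a, y (a + n) = y a)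
    (hyinj : ∀ a b, a < b → b < a + n → y a ≠ y b)
    (hv : ∀ a, mv κ (D a) (v a) = some (v (a + 1)))
    (hkind : ∀ a, κ (v a) = κ' (y a)) (hvinj : ∀ a b, v a = v b → a ≡ b [MOD n]) :
    ∃ a, v (a + n) = v a := by
  set f : ℕ → ℤ := fun s => turn (D s) (κ' (y (s + 1))) (D (s + 1)) with hf
  have hfv : ∀ s, turn (D s) (κ (v (s + 1))) (D (s + 1)) = f s := fun s => by rw [hf, hkind]
  have hfper : ∀ a, f (a + n) = f a := by
    intro a
    simp only [hf]
    rw [show a + n + 1 = a + 1 + n by omega, hD, hD, hyper]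
  have hσ : ∑ s ∈ Finset.range n, f s = 2 ∨ ∑ s ∈ Finset.range n, f s = -2 := by
    obtain ⟨p, -, hp⟩ := exists_forall_le y 0
    have h := sum_turn_closed (κ := κ') (D := fun a => D (p + a)) (v := fun a => y (p + a))
      (fun a => hy (p + a)) hn (fun a => by simpa only [add_assoc] using hyper (p + a))
      (fun a => by simpa only [add_assoc] using hD (p + a))
      (fun a b h1 h2 => hyinj _ _ (by omega) (by omega)) (fun x => hp _ (Nat.zero_le _))
    have h' := sum_range_shift_of_periodic hfper p
    rw [← h']
    exact h
  by_cases hinj : Function.Injective v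
  · exfalso
    obtain ⟨p, -, hp⟩ := exists_forall_le v 0
    obtain ⟨m₀, hm₀⟩ := eventually_sum_range_ne_zero_of_periodic (f := fun a => f (p + a))
      (n := n) (by omega) (fun a => by simpa only [add_assoc] using hfper (p + a)) (by
        rw [sum_range_shift_of_periodic hfper]; omega)
    have hinj' : Function.Injective fun a => v (p + a) := fun a b h => by
      have := hinj h; omega
    obtain ⟨b, hb, hmax⟩ := exists_record hinj' (m₀ + 1)
    obtain ⟨m, rfl⟩ : ∃ m, b = m + 1 := ⟨b - 1, by omega⟩
    refine hm₀ m (by omega) ?_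
    have h := sum_turn_eq_zero (κ := κ) (D := fun a => D (p + a)) (v := fun a => v (p + a))
      (fun a => hv (p + a)) (m := m) (fun x y h1 _ h3 => by have := hinj' h3; omega)
      (fun x => hp _ (Nat.zero_le _)) hmax
    rw [← h]
    exact Finset.sum_congr rfl fun s _ => (hfv (p + s)).symm
  · classical
    have hex : ∃ N, 0 < N ∧ ∃ a, v (a + N) = v a := by
      rw [Function.Injective] at hinj
      push Not at hinj
      obtain ⟨a, b, hab, hne⟩ := hinj
      rcases Nat.lt_or_gt_of_ne hne with h | h
      · exact ⟨b - a, by omega, a, by rw [show a + (b - a) = b by omega, hab]⟩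
      · exact ⟨a - b, by omega, b, by rw [show b + (a - b) = a by omega, hab]⟩
    -- `N` is the length of the shortest closed part of `v`
    obtain ⟨N, ⟨hN0, a, ha⟩, hmin⟩ : ∃ N, (0 < N ∧ ∃ a, v (a + N) = v a) ∧
        ∀ N' < N, ¬ (0 < N' ∧ ∃ a, v (a + N') = v a) :=
      ⟨Nat.find hex, Nat.find_spec hex, fun _ h => Nat.find_min hex h⟩
    obtain ⟨m, rfl⟩ : n ∣ N := by
      have := (hvinj _ _ ha.symm)
      simpa using (Nat.modEq_iff_dvd' (by omega)).1 this
    have hDm : ∀ m a, D (a + n * m) = D a := by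
      intro m a
      induction m with
      | zero => simp
      | succ m ih => rw [Nat.mul_succ, ← add_assoc, hD, ih]
    have hper : ∀ x, v (a + x + n * m) = v (a + x) := by
      intro x
      induction x with
      | zero => exact ha
      | succ x ih =>
        have h1 := hv (a + x + n * m)
        rw [ih, hDm, hv (a + x)] at h1
        simp only [Option.some.injEq] at h1
        rw [← add_assoc, h1]
        congr 1
        omega
    obtain ⟨p, hpa, hp⟩ := exists_forall_le v a
    obtain ⟨p, rfl⟩ : ∃ p', p = a + p' := ⟨p - a, by omega⟩
    have hm : 1 ≤ m := Nat.pos_of_mul_pos_left hN0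
    have h := sum_turn_closed (κ := κ) (D := fun x => D (a + p + x)) (v := fun x => v (a + p + x))
      (N := n * m) (fun x => hv (a + p + x)) (by nlinarith)
      (fun x => by simpa only [add_assoc] using hper (p + x))
      (fun x => by simpa only [add_assoc] using hDm m (a + p + x))
      (fun x z h1 h2 h3 => hmin (z - x) (by omega) ⟨by omega, a + p + x, by
        rw [show a + p + x + (z - x) = a + p + z by omega]; exact h3.symm⟩)
      (fun x => hp _ (by omega))
    have h' : ∑ s ∈ Finset.range (n * m),
        turn (D (a + p + s)) (κ (v (a + p + (s + 1)))) (D (a + p + (s + 1))) =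
        m * ∑ s ∈ Finset.range n, f s := by
      rw [← sum_range_shift_of_periodic hfper (a + p),
        ← sum_range_mul_of_periodic (f := fun x => f (a + p + x)) fun x => by
          simpa only [add_assoc] using hfper (a + p + x)]
      exact Finset.sum_congr rfl fun s _ => hfv (a + p + s)
    rw [h'] at h
    have hm1 : m = 1 := by
      rcases hσ with hσ | hσ <;> rw [hσ] at h <;> omega
    subst hm1
    exact ⟨a, by simpa using ha⟩

/-! ### Local types of positions -/

/-- A local type of radius `R`: the letters at the positions reached by the sequences of at most `R`
moves, as far as these are defined, and the set of those sequences that lead back to the start. -/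
abbrev LocalType (R : ℕ) (X : Type*) : Type _ :=
  ({u : List Move // u.length ≤ R} → Option X) × Set {u : List Move // u.length ≤ R}

instance (R : ℕ) : Finite {u : List Move // u.length ≤ R} :=
  List.finite_length_le Move R

namespace LocalType

variable {R : ℕ} {X : Type*}

/-- The letter at the end of the walk `u` according to a local type. -/
def lab (t : LocalType R X) (u : List Move) : Option X :=
  if h : u.length ≤ R then t.1 ⟨u, h⟩ else none

/-- The walk `u` is closed according to a local type. -/
def Loop (t : LocalType R X) (u : List Move) : Prop := ∃ h : u.length ≤ R, ⟨u, h⟩ ∈ t.2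

theorem ext' {t t' : LocalType R X} (h : ∀ u, u.length ≤ R → t.lab u = t'.lab u)
    (h' : ∀ u, u.length ≤ R → (t.Loop u ↔ t'.Loop u)) : t = t' := by
  refine Prod.ext (funext fun u => ?_) (Set.ext fun u => ?_)
  · simpa [lab, u.2] using h u u.2
  · simpa [Loop, u.2] using h' u u.2

theorem Loop.length_le {t : LocalType R X} {u : List Move} (h : t.Loop u) : u.length ≤ R := h.1

end LocalType

/-- The local type of a position of a labelled nested word. -/
noncomputable def localType (R : ℕ) {X : Type*} (k : X → LetterKind K) (x : ℕ → X) (i : ℕ) :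
    LocalType R X :=
  (fun u => (walk (k ∘ x) u i).map x, {u | walk (k ∘ x) u i = some i})

section

variable {R : ℕ} {X Y : Type*} {k : X → LetterKind K} {col : X → Y} {x : ℕ → X} {i : ℕ}
  {u u' : List Move}

theorem lab_localType (h : u.length ≤ R) :
    (localType R k x i).lab u = (walk (k ∘ x) u i).map x := by
  simp [LocalType.lab, localType, h]

theorem loop_localType :
    (localType R k x i).Loop u ↔ u.length ≤ R ∧ walk (k ∘ x) u i = some i := by
  simp [LocalType.Loop, localType]

/-- Distinct positions joined by a walk of length at most `R` have distinct colours. -/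
def ProperlyColoured (R : ℕ) (k : X → LetterKind K) (col : X → Y) (x : ℕ → X) : Prop :=
  ∀ i j u, u.length ≤ R → walk (k ∘ x) u i = some j → i ≠ j → col (x i) ≠ col (x j)

/-- A local type that occurs in some properly coloured nested word. -/
def Realized (k : X → LetterKind K) (col : X → Y) (t : LocalType R X) : Prop :=
  ∃ x, ProperlyColoured R k col x ∧ ∃ i, t = localType R k x i

namespace Realized

variable {t : LocalType R X}

theorem lab_cons_eq_none (ht : Realized k col t) {d : Move} (h : t.lab [d] = none) :
    t.lab (d :: u) = none := by
  obtain ⟨x, -, i, rfl⟩ := ht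
  by_cases hR : (d :: u).length ≤ R
  · rw [lab_localType (by simp at hR ⊢; omega)] at h
    rw [lab_localType hR, walk_cons]
    simp only [walk_singleton, Option.map_eq_none_iff] at h
    rw [h]; rfl
  · simp only [LocalType.lab, hR, dite_false]

theorem lab_eq_of_loop (ht : Realized k col t) (h : t.Loop u) : t.lab u = t.lab [] := by
  obtain ⟨x, -, i, rfl⟩ := ht
  rw [loop_localType] at h
  rw [lab_localType h.1, lab_localType (Nat.zero_le _), h.2, walk_nil]

/-- In a properly coloured nested word, a short walk ending in the colour of its start is closed. -/
theorem loop_of_col_eq (ht : Realized k col t) (hu : u.length ≤ R) {a b : X}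
    (ha : t.lab u = some a) (hb : t.lab [] = some b) (hab : col a = col b) : t.Loop u := by
  obtain ⟨x, hx, i, rfl⟩ := ht
  rw [lab_localType hu, Option.map_eq_some_iff] at ha
  rw [lab_localType (Nat.zero_le _), walk_nil, Option.map_some, Option.some.injEq] at hb
  obtain ⟨j, hj, rfl⟩ := ha
  subst hb
  rw [loop_localType]
  refine ⟨hu, ?_⟩
  by_contra hne
  refine hx i j u hu hj ?_ hab.symm
  rintro rfl
  exact hne hj

theorem loop_append_left (ht : Realized k col t) (h : t.Loop u') (h' : t.Loop (u ++ u')) :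
    t.Loop u := by
  obtain ⟨x, -, i, rfl⟩ := ht
  rw [loop_localType] at h h' ⊢
  refine ⟨by have := h'.1; simp at this; omega, ?_⟩
  have h2 := h'.2
  rw [walk_append] at h2
  obtain ⟨j, hj, hj'⟩ := Option.bind_eq_some_iff.1 h2
  rw [hj, walk_injective hj' h.2]

end Realized

/-- The local types `t` and `t'` fit together along a move `d` leading from a position of type `t`
to a position of type `t'`. -/
def LocalType.Agree (d : Move) (t t' : LocalType R X) : Prop :=
  (∀ u, (d :: u).length ≤ R → t.lab (d :: u) = t'.lab u) ∧
    ∀ u, t.Loop (d :: u) → t'.Loop (u ++ [d])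

/-- A locally checkable certificate for the local types of the positions of a nested word. -/
structure Certificate (R : ℕ) (k : X → LetterKind K) (col : X → Y) (x : ℕ → X)
    (θ : ℕ → LocalType R X) : Prop where
  realized : ∀ i, Realized k col (θ i)
  self : ∀ i, (θ i).lab [] = some (x i)
  agree : ∀ d i j, mv (k ∘ x) d i = some j → (θ i).Agree d (θ j)
  undef : ∀ d i, mv (k ∘ x) d i = none → (θ i).lab [d] = none

theorem ProperlyColoured.certificate (hx : ProperlyColoured R k col x) :
    Certificate R k col x (localType R k x) where
  realized i := ⟨x, hx, i, rfl⟩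
  self i := by rw [lab_localType (Nat.zero_le _)]; rfl
  agree d i j h := by
    refine ⟨fun u hu => ?_, fun u hu => ?_⟩
    · rw [lab_localType hu, lab_localType (by simp at hu; omega), walk_cons, h]; rfl
    · rw [loop_localType, walk_cons, h] at hu
      rw [loop_localType]
      refine ⟨by simpa using hu.1, ?_⟩
      rw [walk_append_of_eq (j := i) hu.2, walk_singleton, h]
  undef d i h := by
    by_cases hR : 1 ≤ R
    · rw [lab_localType (by simpa using hR), walk_singleton, h]; rfl
    · simp [LocalType.lab, hR]

namespace Certificate

variable {θ : ℕ → LocalType R X}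

theorem lab_eq (h : Certificate R k col x θ) (hu : u.length ≤ R) (i : ℕ) :
    (θ i).lab u = (walk (k ∘ x) u i).map x := by
  induction u generalizing i with
  | nil => exact h.self i
  | cons d u ih =>
    match hd : mv (k ∘ x) d i with
    | none => rw [(h.realized i).lab_cons_eq_none (h.undef d i hd), walk_cons, hd]; rfl
    | some j => rw [(h.agree d i j hd).1 u hu, ih (by simp at hu; omega), walk_cons, hd]; rfl

theorem loop_of_col (h : Certificate R k col x θ) (hu : u.length ≤ R) {i j : ℕ}
    (hw : walk (k ∘ x) u i = some j) (hc : col (x j) = col (x i)) : (θ i).Loop u :=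
  (h.realized i).loop_of_col_eq hu (by rw [h.lab_eq hu, hw]; rfl) (h.self i) hc

theorem loop_rotate (h : Certificate R k col x θ) {i j : ℕ} (hl : (θ i).Loop (u ++ u'))
    (hw : walk (k ∘ x) u i = some j) : (θ j).Loop (u' ++ u) := by
  induction u generalizing i u' with
  | nil =>
    simp only [walk_nil, Option.some.injEq] at hw
    subst hw
    simpa using hl
  | cons d u ih =>
    rw [walk_cons] at hw
    obtain ⟨l, hl', hw⟩ := Option.bind_eq_some_iff.1 hw
    have := (h.agree d i l hl').2 (u ++ u') hl
    rw [List.append_assoc] at this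
    have := ih this hw
    simpa using this

end Certificate

end

/-! ### Sequences of moves read off a periodic one -/

section Segments

variable {D : ℕ → Move} {κ : ℕ → LetterKind K} {n : ℕ}

/-- The moves with the numbers `a, …, a + m - 1`. -/
def segment (D : ℕ → Move) (a m : ℕ) : List Move := (List.range' a m).map D

@[simp] theorem length_segment (a m : ℕ) : (segment D a m).length = m := by simp [segment]

theorem segment_succ (a m : ℕ) : segment D a (m + 1) = D a :: segment D (a + 1) m := by
  simp [segment, List.range'_succ]

theorem segment_add (a m m' : ℕ) :
    segment D a (m + m') = segment D a m ++ segment D (a + m) m' := by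
  simp [segment, ← List.map_append]

theorem segment_shift {p : ℕ} (hD : ∀ a, D (a + p) = D a) (a m : ℕ) :
    segment D (a + p) m = segment D a m := by
  induction m generalizing a with
  | zero => simp [segment]
  | succ m ih => rw [segment_succ, segment_succ, hD, ← ih (a + 1), add_right_comm]

theorem periodic_mul {α : Type*} {f : ℕ → α} (hf : ∀ a, f (a + n) = f a) (q a : ℕ) :
    f (a + n * q) = f a := by
  induction q with
  | zero => simp
  | succ q ih => rw [Nat.mul_succ, ← add_assoc, hf, ih]

theorem walk_segment {v : ℕ → ℕ} (hv : ∀ a, mv κ (D a) (v a) = some (v (a + 1))) (a m : ℕ) :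
    walk κ (segment D a m) (v a) = some (v (a + m)) := by
  induction m generalizing a with
  | zero => simp [segment]
  | succ m ih =>
    rw [segment_succ, walk_cons, hv, Option.bind_some, ih]
    congr 2
    omega

theorem exists_periodic_extension (w : List Move) :
    ∃ D : ℕ → Move, (∀ a, D (a + w.length) = D a) ∧ segment D 0 w.length = w := by
  refine ⟨fun a => w.getD (a % w.length) .succ, fun a => by simp, ?_⟩
  refine List.ext_getElem (by simp) fun a h h' => ?_
  simp [segment, Nat.mod_eq_of_lt h', h']

theorem exists_track {I : ℕ → ℕ → Prop}
    (hI : ∀ a i, I a i → ∃ j, mv κ (D a) i = some j ∧ I (a + 1) j)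
    {i : ℕ} (hi : I 0 i) :
    ∃ v : ℕ → ℕ, v 0 = i ∧ (∀ a, mv κ (D a) (v a) = some (v (a + 1))) ∧ ∀ a, I a (v a) := by
  choose! f hf using hI
  let v : ℕ → ℕ := fun a => Nat.rec i (fun a j => f a j) a
  have hv : ∀ a, I a (v a) := by
    intro a
    induction a with
    | zero => exact hi
    | succ a ih => exact (hf a _ ih).2
  exact ⟨v, rfl, fun a => (hf a _ (hv a)).1, hv⟩

end Segments

/-! ### Soundness of certificates -/

section Soundness

theorem partner_of_adjacent {κ κ' : ℕ → LetterKind K} {p q : ℕ} (h : Partner κ' p (p + 1))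
    (h0 : κ q = κ' p) (h1 : κ (q + 1) = κ' (p + 1)) : Partner κ q (q + 1) := by
  obtain ⟨s, h | h⟩ := h
  · exact ⟨s, .inl (matched_succ (h0.trans h.call) (h1.trans h.ret))⟩
  · have := h.lt
    omega

/-- Closed walks of length two are recognized by the kinds of the letters. -/
theorem eq_of_two_cycle {κ κ' : ℕ → LetterKind K} {d d' : Move} {p p' q q' q'' : ℕ}
    (h1 : mv κ' d p = some p') (h2 : mv κ' d' p' = some p) (h3 : mv κ d q = some q')
    (h4 : mv κ d' q' = some q'') (h0 : κ q = κ' p) (h0' : κ q' = κ' p') (h0'' : κ q'' = κ' p) :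
    q'' = q := by
  cases d <;> cases d' <;> simp only [mv_succ, mv_pred, mv_arc] at h1 h2 h3 h4
  · omega
  · omega
  · subst h1 h3
    exact h4.unique (partner_of_adjacent h2.symm h0 h0').symm
  · omega
  · omega
  · subst h1 h3
    exact h4.unique (partner_of_adjacent h2 h0' h0)
  · subst h2 h4
    exact (partner_of_adjacent h1.symm h0' h0'').unique h3.symm
  · subst h2 h4
    exact (partner_of_adjacent h1 h0'' h0').symm.unique h3.symm
  · exact h4.unique h3.symm

variable {R : ℕ} {X Y : Type*} {k : X → LetterKind 2} {col : X → Y} {x : ℕ → X}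
  {θ : ℕ → LocalType R X}

/-- The induction step for `Certificate.loop_sound`: if a walk `w` that is certified as closed at
position `i` were not closed, then repeating it would yield a walk `v` that can meet itself only at
corresponding points, while in the nested word realizing the local type of `i` the walk `w` is
simple and closed. -/
theorem Certificate.loop_sound_step (h : Certificate R k col x θ) {w : List Move}
    (hmin : ∀ i u, u.length < w.length → (θ i).Loop u → walk (k ∘ x) u i = some i) {i : ℕ}
    (hw : (θ i).Loop w) : walk (k ∘ x) w i = some i := by
  obtain ⟨D, hD, hDw⟩ := exists_periodic_extension w
  set n := w.length with hn
  have hnR : n ≤ R := hw.length_le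
  rcases Nat.eq_zero_or_pos n with h0 | hpos
  · rw [List.length_eq_zero_iff.1 (hn.symm.trans h0)]
    rfl
  have hrot : ∀ a, segment D a n = D a :: segment D (a + 1) (n - 1) := fun a => by
    rw [← segment_succ, Nat.sub_add_cancel hpos]
  have hrot' : ∀ a, segment D (a + 1) (n - 1) ++ [D a] = segment D (a + 1) n := fun a => by
    have : [D a] = segment D (a + 1 + (n - 1)) 1 := by
      rw [show a + 1 + (n - 1) = a + n by omega, segment_shift hD]; rfl
    rw [this, ← segment_add, Nat.sub_add_cancel hpos]
  -- the repetition `v` of `w`, starting at `i`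
  obtain ⟨v, hv0, hv, hvl⟩ := exists_track (κ := k ∘ x) (D := D)
    (I := fun a j => (θ j).Loop (segment D a n)) (by
      intro a j hj
      have hlab := (h.realized j).lab_eq_of_loop hj
      match hm : mv (k ∘ x) (D a) j with
      | none =>
        rw [h.self, hrot, (h.realized j).lab_cons_eq_none (h.undef _ _ hm)] at hlab
        simp at hlab
      | some l =>
        refine ⟨l, rfl, ?_⟩
        rw [hrot] at hj
        rw [← hrot']
        exact (h.agree _ _ _ hm).2 _ hj) (i := i) (by rwa [hDw])
  -- the closed walk `y` realizing `w`
  obtain ⟨x', hx', i', hi'⟩ := h.realized i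
  obtain ⟨y, hy0, hy, hyl⟩ := exists_track (κ := k ∘ x') (D := D)
    (I := fun a j => walk (k ∘ x') (segment D a n) j = some j) (by
      intro a j hj
      rw [hrot, walk_cons] at hj
      obtain ⟨l, hl, hj⟩ := Option.bind_eq_some_iff.1 hj
      refine ⟨l, hl, ?_⟩
      rw [← hrot', walk_append_of_eq hj, walk_singleton, hl]) (i := i') (by
        rw [hi', loop_localType] at hw
        rw [hDw, hw.2])
  have hyper : ∀ a, y (a + n) = y a := fun a => by
    have := (walk_segment hy a n).symm.trans (hyl a)
    simpa using this
  have hxv : ∀ a, x (v (a + n)) = x (v a) := fun a => by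
    have := (h.realized (v a)).lab_eq_of_loop (hvl a)
    rw [h.self, h.lab_eq (by simpa using hnR), walk_segment hv] at this
    simpa using this
  have hxy : ∀ a, x (v a) = x' (y a) := by
    have hlt : ∀ a < n, x (v a) = x' (y a) := by
      intro a ha
      have h1 := h.lab_eq (u := segment D 0 a) (by simp; omega) i
      rw [← hv0, walk_segment hv, hv0, hi', lab_localType (by simp; omega), ← hy0,
        walk_segment hy] at h1
      simpa using h1.symm
    intro a
    have h1 := periodic_mul (f := fun a => x (v a)) hxv (a / n) (a % n)
    have h2 := periodic_mul hyper (a / n) (a % n)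
    rw [Nat.mod_add_div] at h1 h2
    rw [h1, h2]
    exact hlt _ (Nat.mod_lt _ hpos)
  by_contra hfalse
  have hne : ∀ a, v (a + n) ≠ v a := by
    intro a
    induction a with
    | zero =>
      intro h0
      rw [zero_add, hv0] at h0
      have := walk_segment hv 0 n
      rw [hDw, hv0, zero_add, h0] at this
      exact hfalse this
    | succ a ih =>
      intro h0
      refine ih ?_
      have h1 := hv (a + n)
      rw [hD, show a + n + 1 = a + 1 + n by omega, h0, ← walk_singleton] at h1
      exact walk_injective h1 (walk_singleton.trans (hv a))
  -- `v` meets itself only at corresponding points: otherwise shorter walks would be closed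
  have hmod : ∀ a b, v a = v b → a ≡ b [MOD n] := by
    have key : ∀ a b, a ≤ b → v a = v b → a ≡ b [MOD n] := by
      intro a b hab heq
      by_contra hnot
      set t := (b - a) % n with ht
      have htn : t < n := Nat.mod_lt _ hpos
      have ht0 : 0 < t := by
        rcases Nat.eq_zero_or_pos t with h0 | h0
        · exact absurd ((Nat.modEq_iff_dvd' hab).2 (Nat.dvd_of_mod_eq_zero h0)) hnot
        · exact h0
      have hb : b = a + t + n * ((b - a) / n) := by
        have := Nat.mod_add_div (b - a) n
        omega
      have hu : segment D b (n - t) = segment D (a + t) (n - t) := by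
        rw [hb]
        exact segment_shift (periodic_mul hD _) _ _
      have hsplit : segment D a n = segment D a t ++ segment D (a + t) (n - t) := by
        rw [← segment_add, show t + (n - t) = n by omega]
      have hwalk := walk_segment hv b (n - t)
      have hxb : x (v (b + (n - t))) = x (v a) := by
        rw [show b + (n - t) = a + n * ((b - a) / n + 1) by rw [Nat.mul_succ]; omega]
        exact periodic_mul (f := fun a => x (v a)) hxv _ _
      rw [hu, ← heq] at hwalk
      have hl1 : (θ (v a)).Loop (segment D (a + t) (n - t)) :=
        h.loop_of_col (by simp; omega) hwalk (by rw [hxb])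
      have hl2 : (θ (v a)).Loop (segment D a t) :=
        (h.realized (v a)).loop_append_left hl1 (by rw [← hsplit]; exact hvl a)
      have hc1 := hmin _ _ (by simp; omega) hl1
      have hc2 := hmin _ _ (by simpa using htn) hl2
      have hc3 := walk_append_of_eq hc2 (segment D (a + t) (n - t))
      rw [hc1, ← hsplit, walk_segment hv] at hc3
      exact hne a (by simpa using hc3)
    intro a b heq
    rcases le_total a b with hab | hab
    · exact key a b hab heq
    · exact (key b a hab heq.symm).symm
  -- `y` is simple for the same reason
  have hyinj : ∀ s t, s < t → t < n → y s ≠ y t := by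
    intro s t hst htn heq
    have h1 : (θ i).Loop (segment D 0 s ++ segment D t (n - t)) := by
      rw [hi', loop_localType]
      refine ⟨by simp; omega, ?_⟩
      have e1 := walk_segment hy 0 s
      have e2 := walk_segment hy t (n - t)
      rw [hy0, zero_add] at e1
      rw [walk_append_of_eq e1, heq, e2, show t + (n - t) = 0 + n by omega, hyper, hy0]
    have e1 := walk_segment hv 0 s
    rw [hv0, zero_add] at e1
    have h2 := h.loop_rotate h1 e1
    have h3 : segment D s n =
        segment D s (t - s) ++ (segment D t (n - t) ++ segment D 0 s) := by
      rw [← segment_shift hD 0 s]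
      conv_lhs => rw [show n = t - s + (n - t + s) by omega]
      rw [segment_add, segment_add]
      congr 3 <;> omega
    have h4 := (h.realized (v s)).loop_append_left h2 (by rw [← h3]; exact hvl s)
    have h5 := hmin _ _ (by simp; omega) h4
    rw [walk_segment hv] at h5
    have h6 := hmod _ _ (Option.some.inj h5)
    rw [show s + (t - s) = t by omega] at h6
    have h7 := h6.eq_of_lt_of_lt htn (by omega)
    omega
  rcases Nat.lt_or_ge n 3 with hn3 | hn3
  · obtain hn1 | hn2 : n = 1 ∨ n = 2 := by omega
    · have := hy 0
      rw [show 0 + 1 = 0 + n by omega, hyper] at this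
      exact mv_ne this rfl
    · refine hne 0 ?_
      have e1 := hy 1
      rw [show 1 + 1 = 0 + n by omega, hyper] at e1
      have e2 := hv 1
      rw [show 1 + 1 = 0 + n by omega] at e2
      exact eq_of_two_cycle (hy 0) e1 (hv 0) e2 (congrArg k (hxy 0)) (congrArg k (hxy 1))
        (congrArg k ((hxy (0 + n)).trans (congrArg x' (hyper 0))))
  · obtain ⟨a, ha⟩ := closed_of_closed (κ := k ∘ x) (κ' := k ∘ x') hn3 hD hy hyper (by
      intro a b hab hba heq
      have hper := fun c => periodic_mul hyper (c / n) (c % n)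
      simp only [Nat.mod_add_div] at hper
      rw [hper a, hper b] at heq
      have ha := Nat.mod_lt a hpos
      have hb := Nat.mod_lt b hpos
      rcases lt_trichotomy (a % n) (b % n) with hlt | he | hlt
      · exact hyinj _ _ hlt hb heq
      · have := (Nat.modEq_iff_dvd' hab.le).1 he
        have := Nat.le_of_dvd (by omega) this
        omega
      · exact hyinj _ _ hlt ha heq.symm) hv (fun a => congrArg k (hxy a)) hmod
    exact hne a ha

theorem Certificate.loop_sound (h : Certificate R k col x θ) (w : List Move) :
    ∀ i, (θ i).Loop w → walk (k ∘ x) w i = some i := by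
  induction hn : w.length using Nat.strong_induction_on generalizing w with
  | _ n ih =>
    subst hn
    exact fun i => h.loop_sound_step fun i u hu => ih _ hu u rfl i

/-- Over two stacks, a certificate determines the local types. -/
theorem Certificate.eq_localType (h : Certificate R k col x θ) : θ = localType R k x := by
  funext i
  refine LocalType.ext' (fun u hu => ?_) fun u hu => ?_
  · rw [h.lab_eq hu, lab_localType hu]
  · rw [loop_localType]
    exact ⟨fun hl => ⟨hu, h.loop_sound u i hl⟩, fun hl => h.loop_of_col hu hl.2 rfl⟩

end Soundness

/-! ### Existence of colourings -/

/-- Greedy colouring of a graph on the natural numbers all of whose degrees are bounded. -/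
theorem exists_greedy_colouring {ι : Type*} [Finite ι] (g : ℕ → ι → ℕ) :
    ∃ f : ℕ → Fin (Nat.card ι + 1), ∀ i a, g i a < i → f i ≠ f (g i a) := by
  have hex : ∀ (i : ℕ) (r : ∀ j < i, Fin (Nat.card ι + 1)), ∃ c : Fin (Nat.card ι + 1),
      ∀ a (h : g i a < i), c ≠ r _ h := by
    intro i r
    by_contra! hno
    choose a ha hr using hno
    have hinj : Function.Injective a := by
      intro c c' h
      rw [hr c, hr c']
      simp only [h]
    have := Nat.card_le_card_of_injective a hinj
    simp at this
  choose c hc using hex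
  refine ⟨Nat.lt_wfRel.wf.fix c, fun i a h => ?_⟩
  rw [WellFounded.fix_eq]
  exact hc i _ a h

theorem exists_properlyColoured (R : ℕ) : ∃ m : ℕ, ∀ {X : Type} (k : X → LetterKind K)
    (x : ℕ → X), ∃ f : ℕ → Fin m,
      ProperlyColoured R (k ∘ Prod.fst) Prod.snd fun i => (x i, f i) := by
  refine ⟨Nat.card {u : List Move // u.length ≤ R} + 1, fun k x => ?_⟩
  obtain ⟨f, hf⟩ := exists_greedy_colouring (ι := {u : List Move // u.length ≤ R})
    fun i u => (walk (k ∘ x) u i).getD 0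
  refine ⟨f, fun i j u hu hw hij => ?_⟩
  rcases Nat.lt_or_gt_of_ne hij with h | h
  · have hw' := walk_invWord_of hw
    have := hf j ⟨invWord u, by simpa using hu⟩
    change walk (k ∘ x) _ _ = _ at hw'
    simp only [hw', Option.getD_some] at this
    exact (this h).symm
  · have := hf i ⟨u, hu⟩
    change walk (k ∘ x) _ _ = _ at hw
    simp only [hw, Option.getD_some] at this
    exact this h

/-! ### Recognizability of local types -/

theorem not_partner_iff {κ : ℕ → LetterKind K} {i : ℕ} : (∀ j, ¬ Partner κ i j) ↔
    κ i = .int ∨ (∃ s, κ i = .ret s ∧ pending κ s i = []) ∨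
      ∃ s, κ i = .call s ∧ ∀ j, ¬ Matched κ s i j := by
  constructor
  · intro h
    match hk : κ i with
    | .int => exact .inl rfl
    | .ret s =>
      refine .inr (.inl ⟨s, rfl, ?_⟩)
      by_contra hp
      obtain ⟨j, hj⟩ := exists_matched_of_ret hk hp
      exact h j ⟨s, .inr hj⟩
    | .call s => exact .inr (.inr ⟨s, rfl, fun j hj => h j ⟨s, .inl hj⟩⟩)
  · rintro (h | ⟨s, h, hp⟩ | ⟨s, h, hu⟩) j ⟨t, hm | hm⟩
    · simpa [h] using hm.call
    · simpa [h] using hm.ret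
    · simpa [h] using hm.call
    · obtain rfl : s = t := by simpa [h] using hm.ret
      exact hm.pending_ne_nil hp
    · obtain rfl : s = t := by simpa [h] using hm.call
      exact hu j hm
    · simpa [h] using hm.ret

theorem mv_arc_eq_none {κ : ℕ → LetterKind K} {i : ℕ} :
    mv κ .arc i = none ↔ ∀ j, ¬ Partner κ i j := by
  rw [Option.eq_none_iff_forall_ne_some]
  exact forall_congr' fun j => not_congr mv_arc

theorem recognizable_certificate {X Y : Type} (R : ℕ) (k : X → LetterKind K) (col : X → Y) :
    Recognizable (C := X × LocalType R X) (k ∘ Prod.fst) fun e =>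
      Certificate R k col (fun i => (e i).1) fun i => (e i).2 := by
  have h := (((((((Recognizable.forall_letter (k := k ∘ Prod.fst)
      fun e : X × LocalType R X => Realized k col e.2 ∧ e.2.lab [] = some e.1).and
    (.step fun e e' => e.2.Agree .succ e'.2 ∧ e'.2.Agree .pred e.2)).and
    (.matched fun e e' => e.2.Agree .arc e'.2 ∧ e'.2.Agree .arc e.2)).and
    (.init fun e => e.2.lab [.pred] = none)).and
    (.forall_letter fun e => k e.1 = .int → e.2.lab [.arc] = none)).and
    (.unmatched_ret fun e => e.2.lab [.arc] = none)).and
    (.all fun s => .unmatched_call s fun e => e.2.lab [.arc] = none))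
  refine h.congr fun e => ?_
  constructor
  · rintro ⟨⟨⟨⟨⟨⟨h1, h2⟩, h3⟩, h4⟩, h5⟩, h6⟩, h7⟩
    refine ⟨fun i => (h1 i).1, fun i => (h1 i).2, ?_, ?_⟩
    · intro d i j hd
      cases d
      · rw [mv_succ] at hd
        subst hd
        exact (h2 i).1
      · rw [mv_pred] at hd
        subst hd
        exact (h2 j).2
      · obtain ⟨s, hm | hm⟩ := mv_arc.1 hd
        · exact (h3 s i j hm).1
        · exact (h3 s j i hm).2
    · intro d i hd
      cases d
      · simp [mv] at hd
      · cases i with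
        | zero => exact h4
        | succ i => simp [mv] at hd
      · rw [mv_arc_eq_none, not_partner_iff] at hd
        rcases hd with hd | ⟨s, hd, hp⟩ | ⟨s, hd, hu⟩
        · exact h5 i hd
        · exact h6 s i hd hp
        · exact h7 s i hd hu
  · intro h
    refine ⟨⟨⟨⟨⟨⟨fun i => ⟨h.realized i, h.self i⟩, fun i => ⟨h.agree _ _ _ (mv_succ.2 rfl),
      h.agree _ _ _ (mv_pred.2 rfl)⟩⟩, fun s i j hm => ⟨h.agree _ _ _ (mv_arc.2 ⟨s, .inl hm⟩),
      h.agree _ _ _ (mv_arc.2 ⟨s, .inr hm⟩)⟩⟩, h.undef .pred 0 rfl⟩, fun i hi => ?_⟩,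
      fun s i hi hp => ?_⟩, fun s i hi hu => ?_⟩
    · exact h.undef _ _ (mv_arc_eq_none.2 (not_partner_iff.2 (.inl hi)))
    · exact h.undef _ _ (mv_arc_eq_none.2 (not_partner_iff.2 (.inr (.inl ⟨s, hi, hp⟩))))
    · exact h.undef _ _ (mv_arc_eq_none.2 (not_partner_iff.2 (.inr (.inr ⟨s, hi, hu⟩))))

/-- The local type obtained by applying a map to the letters. -/
def LocalType.map {R : ℕ} {X X' : Type*} (f : X → X') (t : LocalType R X) : LocalType R X' :=
  (fun u => (t.1 u).map f, t.2)

theorem map_localType {R : ℕ} {X X' : Type*} (f : X → X') (k : X' → LetterKind K) (x : ℕ → X)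
    (i : ℕ) : (localType R (k ∘ f) x i).map f = localType R k (f ∘ x) i := by
  refine Prod.ext (funext fun u => ?_) rfl
  simp [LocalType.map, localType, Option.map_map, Function.comp_assoc]

/-- The annotation of a nested word over two stacks by the local types of its positions is
recognizable: guess a proper colouring together with a certificate. -/
theorem recognizable_localType {C : Type} [Finite C] (R : ℕ) (k : C → LetterKind 2) :
    Recognizable (C := C × LocalType R C) (k ∘ Prod.fst) fun e =>
      ∀ i, (e i).2 = localType R k (fun i => (e i).1) i := by
  obtain ⟨m, hm⟩ := exists_properlyColoured (K := 2) R
  have h1 := (recognizable_certificate R (k ∘ Prod.fst) (Prod.snd : C × Fin m → Fin m)).comap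
    (k := (k ∘ Prod.fst) ∘ Prod.fst)
    (fun e : (C × LocalType R C) × (Fin m × LocalType R (C × Fin m)) =>
      ((e.1.1, e.2.1), e.2.2)) rfl
  have h2 := (h1.and (.forall_letter fun e => e.1.2 = e.2.2.map Prod.fst)).ex
  refine h2.congr fun e => ?_
  constructor
  · rintro ⟨δ, h, h'⟩ i
    have := congrFun h.eq_localType i
    simp only [Function.comp_apply] at this h'
    rw [h' i, this, map_localType]
    rfl
  · intro h
    obtain ⟨f, hf⟩ := hm k fun i => (e i).1
    refine ⟨fun i => (f i, localType R (k ∘ Prod.fst) (fun i => ((e i).1, f i)) i),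
      hf.certificate, fun i => ?_⟩
    rw [h i, map_localType]
    rfl

/-! ### Recognizability of counting conditions -/

open Classical in
theorem exists_forall_min_card_eq (S : Set ℕ) (n : ℕ) : ∃ N, ∀ i ≥ N,
    ((min n ((Finset.range (i + 1)).filter (· ∈ S)).card : ℕ) : ℕ∞) = min S.encard n := by
  by_cases hS : S.Finite
  · obtain ⟨N, hN⟩ := hS.bddAbove
    refine ⟨N, fun i hi => ?_⟩
    have : (((Finset.range (i + 1)).filter (· ∈ S) : Finset ℕ) : Set ℕ) = S := by
      ext j
      simp only [Finset.coe_filter, Finset.mem_range, Set.mem_ofPred_eq, and_iff_right_iff_imp]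
      intro hj
      have := hN hj
      omega
    rw [← this, Set.encard_coe_eq_coe_finsetCard, this, min_comm]
    exact Nat.mono_cast.map_min
  · obtain ⟨t, htS, rfl⟩ := Set.Infinite.exists_subset_card_eq hS n
    obtain ⟨N, hN⟩ := t.bddAbove
    refine ⟨N, fun i hi => ?_⟩
    have : t ⊆ (Finset.range (i + 1)).filter (· ∈ S) := by
      intro j hj
      have := hN (Finset.mem_coe.2 hj)
      exact Finset.mem_filter.2 ⟨Finset.mem_range.2 (by omega), htS hj⟩
    rw [min_eq_left (Finset.card_le_card this), Set.Infinite.encard_eq hS, min_eq_right le_top]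

open Classical in
/-- The number of letters satisfying `R`, capped at `n`, can be compared with a constant annotation:
a counter capped at `n` eventually has this value, hence takes no other value infinitely often. -/
theorem recognizable_count {C : Type} (k : C → LetterKind K) (n : ℕ) (R : C → Prop)
    (val : C → Fin (n + 1)) :
    Recognizable k fun c => (∀ i, val (c i) = val (c (i + 1))) ∧
      min {i | R (c i)}.encard n = (val (c 0) : ℕ) := by
  have h := ((((Recognizable.step (k := k ∘ Prod.fst)
      fun e e' : C × Fin (n + 1) => val e.1 = val e'.1).and
    (.init fun e => (e.2 : ℕ) = min n (if R e.1 then 1 else 0))).and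
    (.step fun e e' => (e'.2 : ℕ) = min n (e.2 + if R e'.1 then 1 else 0))).and
    (.infinite fun e => e.2 = val e.1)).ex
  refine h.congr fun c => ?_
  set S : Set ℕ := {i | R (c i)} with hS
  obtain ⟨N, hN⟩ := exists_forall_min_card_eq S n
  have hrec : ∀ i, min n (((Finset.range (i + 1 + 1)).filter (· ∈ S)).card) =
      min n (min n (((Finset.range (i + 1)).filter (· ∈ S)).card) +
        if R (c (i + 1)) then 1 else 0) := by
    intro i
    rw [Finset.range_add_one (n := i + 1), Finset.filter_insert]
    simp only [hS, Set.mem_ofPred_eq]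
    split_ifs
    · rw [Finset.card_insert_of_notMem (by simp)]
      omega
    · omega
  have hzero : min n (((Finset.range (0 + 1)).filter (· ∈ S)).card) =
      min n (if R (c 0) then 1 else 0) := by
    simp only [zero_add, Finset.range_one, Finset.filter_singleton, hS, Set.mem_ofPred_eq]
    split_ifs <;> rfl
  constructor
  · rintro ⟨δ, ⟨⟨h1, h2⟩, h3⟩, h4⟩
    refine ⟨h1, ?_⟩
    have hδ : ∀ i, (δ i : ℕ) = min n (((Finset.range (i + 1)).filter (· ∈ S)).card) := by
      intro i
      induction i with
      | zero => rw [hzero]; exact h2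
      | succ i ih => rw [hrec, ← ih]; exact h3 i
    have hval : ∀ i, val (c i) = val (c 0) := by
      intro i
      induction i with
      | zero => rfl
      | succ i ih => rw [← ih]; exact (h1 i).symm
    obtain ⟨i, hi, hNi⟩ := (Set.infinite_iff_exists_gt.1 h4) N
    rw [← hN i hNi.le, ← hδ, ← hval i]
    exact congrArg (fun a : Fin (n + 1) => ((a : ℕ) : ℕ∞)) hi
  · rintro ⟨h1, h2⟩
    have hval : ∀ i, val (c i) = val (c 0) := by
      intro i
      induction i with
      | zero => rfl
      | succ i ih => rw [← ih]; exact (h1 i).symm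
    refine ⟨fun i => ⟨min n (((Finset.range (i + 1)).filter (· ∈ S)).card), by omega⟩,
      ⟨⟨h1, hzero⟩, hrec⟩, Set.infinite_iff_exists_gt.2 fun m => ⟨max N m + 1, ?_, by omega⟩⟩
    refine Fin.ext ?_
    have := hN (max N m + 1) (by omega)
    rw [h2] at this
    rw [hval]
    exact_mod_cast this

/-- Whether infinitely many letters satisfy `R` can be compared with a constant annotation: that
there are only finitely many is certified by a guess of when the last one has occurred. -/
theorem recognizable_infinite_iff {C : Type} (k : C → LetterKind K) (R val : C → Prop) :
    Recognizable k fun c => (∀ i, val (c i) ↔ val (c (i + 1))) ∧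
      ({i | R (c i)}.Infinite ↔ val (c 0)) := by
  have h := (((((Recognizable.step (k := k ∘ Prod.fst)
      fun e e' : C × Prop => val e.1 ↔ val e'.1).and
    (.infinite fun e => val e.1 → R e.1)).and
    (.step fun e e' => e.2 → e'.2)).and
    (.forall_letter fun e => e.2 → ¬ val e.1 → ¬ R e.1)).and
    (.infinite fun e => e.2)).ex
  refine h.congr fun c => ?_
  have hval : (∀ i, val (c i) ↔ val (c (i + 1))) → ∀ i, val (c i) ↔ val (c 0) := by
    intro h i
    induction i with
    | zero => rfl
    | succ i ih => rw [← ih]; exact (h i).symm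
  constructor
  · rintro ⟨δ, ⟨⟨⟨h1, h2⟩, h3⟩, h4⟩, h5⟩
    have hv := hval h1
    refine ⟨h1, fun hinf => ?_, fun h0 => ?_⟩
    · by_contra h0
      obtain ⟨N, hN, -⟩ := (Set.infinite_iff_exists_gt.1 h5) 0
      have hmono : ∀ i ≥ N, δ i := by
        intro i hi
        induction i, hi using Nat.le_induction with
        | base => exact hN
        | succ i _ ih => exact h3 i ih
      obtain ⟨i, hi, hNi⟩ := (Set.infinite_iff_exists_gt.1 hinf) N
      exact h4 i (hmono i hNi.le) (by rwa [hv i]) hi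
    · exact h2.mono fun i (hi : val (c i) → R (c i)) => hi ((hv i).2 h0)
  · rintro ⟨h1, h2⟩
    have hv := hval h1
    by_cases h0 : val (c 0)
    · refine ⟨fun _ => True, ⟨⟨⟨h1, ?_⟩, fun _ => id⟩, fun i _ h => absurd ((hv i).2 h0) h⟩, ?_⟩
      · exact (h2.2 h0).mono fun i hi _ => hi
      · simpa using Set.infinite_univ
    · have hfin : {i | R (c i)}.Finite := by
        by_contra hinf
        exact h0 (h2.1 hinf)
      obtain ⟨N, hN⟩ := hfin.bddAbove
      refine ⟨fun i => N < i, ⟨⟨⟨h1, ?_⟩, fun i (h : N < i) => ?_⟩, ?_⟩, ?_⟩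
      · exact Set.infinite_univ.mono fun i _ h => absurd ((hv i).1 h) h0
      · change N < i + 1
        omega
      · intro i hi _ hR
        have := hN hR
        change N < i at hi
        omega
      · exact Set.Ioi_infinite N

/-- Two nested words have the same numbers of occurrences of local types of radius `r`, up to the
threshold `n`, and the same local types occur infinitely often. For the sake of monotonicity in `r`
sets of local types are counted. -/
def CountEq {C : Type*} (k : C → LetterKind K) (r n : ℕ) (c c' : ℕ → C) : Prop :=
  ∀ Q : Set (LocalType r C),
    min {i | localType r k c i ∈ Q}.encard n = min {i | localType r k c' i ∈ Q}.encard n ∧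
    ({i | localType r k c i ∈ Q}.Infinite ↔ {i | localType r k c' i ∈ Q}.Infinite)

theorem recognizable_of_countEq {C : Type} [Finite C] (k : C → LetterKind 2) (r n : ℕ)
    {P : (ℕ → C) → Prop} (hP : ∀ c c', CountEq k r n c c' → P c → P c') : Recognizable k P := by
  let Profile := Set (LocalType r C) → Fin (n + 1) × Prop
  let IsProfile : Profile → (ℕ → C) → Prop := fun p c => ∀ Q,
    min {i | localType r k c i ∈ Q}.encard n = ((p Q).1 : ℕ) ∧
      ({i | localType r k c i ∈ Q}.Infinite ↔ (p Q).2)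
  have hex : ∀ c, ∃ p, IsProfile p c := by
    intro c
    have : ∀ Q : Set (LocalType r C), ∃ m : Fin (n + 1),
        min {i | localType r k c i ∈ Q}.encard n = (m : ℕ) := by
      intro Q
      have hle : min {i | localType r k c i ∈ Q}.encard n ≤ (n : ℕ∞) := min_le_right _ _
      obtain ⟨m, hm⟩ := ENat.ne_top_iff_exists.1 (ne_top_of_le_ne_top (ENat.natCast_ne_top n) hle)
      rw [← hm] at hle ⊢
      exact ⟨⟨m, by have : m ≤ n := by exact_mod_cast hle
                    omega⟩, rfl⟩
    choose m hm using this
    exact ⟨fun Q => (m Q, _), fun Q => ⟨hm Q, Iff.rfl⟩⟩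
  -- annotate every position by its local type and by the profile of the whole word
  have h1 := (recognizable_localType r k).comap
    (k := k ∘ Prod.fst) (fun e : C × (LocalType r C × Profile) => (e.1, e.2.1)) rfl
  have h2 := ((((h1.and (.step fun e e' => e.2.2 = e'.2.2)).and
    (.init fun e => ∃ c, P c ∧ IsProfile e.2.2 c)).and
    (.all fun Q => recognizable_count _ n (fun e => e.2.1 ∈ Q) fun e => (e.2.2 Q).1)).and
    (.all fun Q => recognizable_infinite_iff _ (fun e => e.2.1 ∈ Q) fun e => (e.2.2 Q).2)).ex
  refine h2.congr fun c => ?_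
  constructor
  · rintro ⟨δ, ⟨⟨⟨h1, h2⟩, ⟨c', hc', hp⟩⟩, h4⟩, h5⟩
    have h1' : ∀ i, (δ i).1 = localType r k c i := h1
    refine hP c' c (fun Q => ?_) hc'
    have e1 := (h4 Q).2
    have e2 := (h5 Q).2
    simp only [h1'] at e1 e2
    exact ⟨(hp Q).1.trans e1.symm, (hp Q).2.trans e2.symm⟩
  · intro hc
    obtain ⟨p, hp⟩ := hex c
    exact ⟨fun i => (localType r k c i, p), ⟨⟨⟨fun _ => rfl, fun _ => rfl⟩, c, hc, hp⟩,
      fun Q => ⟨fun _ => rfl, (hp Q).1⟩⟩, fun Q => ⟨fun _ => Iff.rfl, (hp Q).2⟩⟩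

/-! ### Hanf's theorem for first-order logic with the infinity quantifier -/

section Hanf

theorem CountEq.mono {C : Type*} {k : C → LetterKind K} {r r' n n' : ℕ} {c c' : ℕ → C}
    (h : CountEq k r' n' c c') (hr : r ≤ r') (hn : n ≤ n') : CountEq k r n c c' := by
  intro Q
  obtain ⟨h1, h2⟩ := h ((fun t : LocalType r' C =>
    ((fun u => t.1 ⟨u.1, u.2.trans hr⟩, {u | ⟨u.1, u.2.trans hr⟩ ∈ t.2}) : LocalType r C)) ⁻¹' Q)
  refine ⟨?_, h2⟩
  have hnn : ((n' : ℕ∞) ⊓ n) = n := min_eq_right (by exact_mod_cast hn)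
  have h3 := congrArg (fun m : ℕ∞ => min m n) h1
  simp only [min_assoc, hnn] at h3
  exact h3

theorem CountEq.symm {C : Type*} {k : C → LetterKind K} {r n : ℕ} {c c' : ℕ → C}
    (h : CountEq k r n c c') : CountEq k r n c' c :=
  fun Q => ⟨(h Q).1.symm, (h Q).2.symm⟩

/-- The positions `v x` in `c` and `v' x` in `c'`, for `x ∈ F`, have the same joint local type of
radius `r`. -/
def JointEq {C : Type*} (k : C → LetterKind K) (r : ℕ) (F : Finset ℕ) (c c' : ℕ → C)
    (v v' : ℕ → ℕ) : Prop :=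
  ∀ x ∈ F, ∀ u : List Move, u.length ≤ r →
    (walk (k ∘ c) u (v x)).map c = (walk (k ∘ c') u (v' x)).map c' ∧
    ∀ y ∈ F, walk (k ∘ c) u (v x) = some (v y) ↔ walk (k ∘ c') u (v' x) = some (v' y)

variable {C : Type*} {k : C → LetterKind K} {r n : ℕ} {F : Finset ℕ} {c c' : ℕ → C}
  {v v' : ℕ → ℕ} {x : ℕ}

theorem JointEq.symm (h : JointEq k r F c c' v v') : JointEq k r F c' c v' v :=
  fun x hx u hu => ⟨(h x hx u hu).1.symm, fun y hy => ((h x hx u hu).2 y hy).symm⟩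

theorem JointEq.mono {r' : ℕ} {F' : Finset ℕ} (h : JointEq k r' F' c c' v v') (hr : r ≤ r')
    (hF : F ⊆ F') : JointEq k r F c c' v v' :=
  fun x hx u hu => ⟨(h x (hF hx) u (hu.trans hr)).1,
    fun y hy => (h x (hF hx) u (hu.trans hr)).2 y (hF hy)⟩

theorem JointEq.localType_eq (h : JointEq k r F c c' v v') (hx : x ∈ F) :
    localType r k c (v x) = localType r k c' (v' x) :=
  Prod.ext (funext fun u => (h x hx u.1 u.2).1)
    (Set.ext fun u => (h x hx u.1 u.2).2 x hx)

/-- Position `i` is reached by a walk of length at most `r` from the position of a variable in `F`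
other than `x`. -/
def Near (κ : ℕ → LetterKind K) (r : ℕ) (F : Finset ℕ) (x : ℕ) (v : ℕ → ℕ) (i : ℕ) : Prop :=
  ∃ y ∈ F, y ≠ x ∧ ∃ u : List Move, u.length ≤ r ∧ walk κ u (v y) = some i

theorem walk_eq_some_iff_append_invWord {κ : ℕ → LetterKind K} {u w : List Move} {a b i : ℕ}
    (h : walk κ u b = some i) : walk κ w a = some i ↔ walk κ (w ++ invWord u) a = some b := by
  constructor
  · intro hw
    rw [walk_append_of_eq hw, walk_invWord_of h]
  · intro hw
    rw [walk_append] at hw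
    obtain ⟨l, hl, hl'⟩ := Option.bind_eq_some_iff.1 hw
    rw [walk_invWord, h, Option.some.injEq] at hl'
    rw [hl, hl']

/-- A position close to those of the other variables is answered by moving in the same way. -/
theorem JointEq.near (h : JointEq k (3 * r) F c c' v v') {y : ℕ} (hy : y ∈ F) (hyx : y ≠ x)
    {u : List Move} (hu : u.length ≤ r) {i : ℕ} (hi : walk (k ∘ c) u (v y) = some i) :
    ∃ i', walk (k ∘ c') u (v' y) = some i' ∧
      JointEq k r (insert x F) c c' (Function.update v x i) (Function.update v' x i') := by
  have h1 := (h y hy u (by omega)).1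
  rw [hi, Option.map_some] at h1
  obtain ⟨i', hi', -⟩ := Option.map_eq_some_iff.1 h1.symm
  refine ⟨i', hi', fun z hz w hw => ?_⟩
  by_cases hzx : z = x
  · subst hzx
    simp only [Function.update_self]
    rw [← walk_append_of_eq hi, ← walk_append_of_eq hi']
    have hlen : (u ++ w).length ≤ 3 * r := by simp; omega
    refine ⟨(h y hy _ hlen).1, fun z' hz' => ?_⟩
    by_cases hz'x : z' = z
    · subst hz'x
      simp only [Function.update_self]
      rw [walk_eq_some_iff_append_invWord hi, walk_eq_some_iff_append_invWord hi']
      exact (h y hy _ (by simp; omega)).2 y hy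
    · rw [Function.update_of_ne hz'x, Function.update_of_ne hz'x]
      exact (h y hy _ hlen).2 z' (Finset.mem_of_mem_insert_of_ne hz' hz'x)
  · have hzF := Finset.mem_of_mem_insert_of_ne hz hzx
    rw [Function.update_of_ne hzx, Function.update_of_ne hzx]
    refine ⟨(h z hzF w (by omega)).1, fun z' hz' => ?_⟩
    by_cases hz'x : z' = x
    · subst hz'x
      simp only [Function.update_self]
      rw [walk_eq_some_iff_append_invWord hi, walk_eq_some_iff_append_invWord hi']
      exact (h z hzF _ (by simp; omega)).2 y hy
    · rw [Function.update_of_ne hz'x, Function.update_of_ne hz'x]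
      exact (h z hzF w (by omega)).2 z' (Finset.mem_of_mem_insert_of_ne hz' hz'x)

/-- A position far from those of the other variables may be answered by any far position with the
same local type. -/
theorem JointEq.far (h : JointEq k r F c c' v v') {i i' : ℕ}
    (ht : localType r k c i = localType r k c' i') (hi : ¬ Near (k ∘ c) r F x v i)
    (hi' : ¬ Near (k ∘ c') r F x v' i') :
    JointEq k r (insert x F) c c' (Function.update v x i) (Function.update v' x i') := by
  intro z hz w hw
  by_cases hzx : z = x
  · subst hzx
    simp only [Function.update_self]
    refine ⟨congrFun (congrArg Prod.fst ht) ⟨w, hw⟩, fun z' hz' => ?_⟩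
    by_cases hz'x : z' = z
    · subst hz'x
      simp only [Function.update_self]
      have := congrArg (fun t : LocalType r C =>
        (⟨w, hw⟩ : {u : List Move // u.length ≤ r}) ∈ t.2) ht
      exact iff_of_eq this
    · rw [Function.update_of_ne hz'x, Function.update_of_ne hz'x]
      have hz'F := Finset.mem_of_mem_insert_of_ne hz' hz'x
      refine iff_of_false (fun hw' => hi ?_) fun hw' => hi' ?_
      · exact ⟨z', hz'F, hz'x, invWord w, by simpa using hw, walk_invWord_of hw'⟩
      · exact ⟨z', hz'F, hz'x, invWord w, by simpa using hw, walk_invWord_of hw'⟩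
  · have hzF := Finset.mem_of_mem_insert_of_ne hz hzx
    rw [Function.update_of_ne hzx, Function.update_of_ne hzx]
    refine ⟨(h z hzF w hw).1, fun z' hz' => ?_⟩
    by_cases hz'x : z' = x
    · subst hz'x
      simp only [Function.update_self]
      exact iff_of_false (fun hw' => hi ⟨z, hzF, hzx, w, hw, hw'⟩)
        fun hw' => hi' ⟨z, hzF, hzx, w, hw, hw'⟩
    · rw [Function.update_of_ne hz'x, Function.update_of_ne hz'x]
      exact (h z hzF w hw).2 z' (Finset.mem_of_mem_insert_of_ne hz' hz'x)

theorem near_subset_range (κ : ℕ → LetterKind K) (r : ℕ) (F : Finset ℕ) (x : ℕ) (v : ℕ → ℕ) :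
    {i | Near κ r F x v i} ⊆ Set.range fun p : F × {u : List Move // u.length ≤ r} =>
      (walk κ p.2 (v p.1)).getD 0 := by
  rintro i ⟨y, hy, -, u, hu, hi⟩
  exact ⟨(⟨y, hy⟩, ⟨u, hu⟩), by simp [hi]⟩

theorem near_finite (κ : ℕ → LetterKind K) (r : ℕ) (F : Finset ℕ) (x : ℕ) (v : ℕ → ℕ) :
    {i | Near κ r F x v i}.Finite :=
  (Set.finite_range _).subset (near_subset_range κ r F x v)

theorem encard_near_le (κ : ℕ → LetterKind K) (r : ℕ) (F : Finset ℕ) (x : ℕ) (v : ℕ → ℕ) :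
    {i | Near κ r F x v i}.encard ≤
      Nat.card (F × {u : List Move // u.length ≤ r}) := by
  refine (Set.encard_le_encard (near_subset_range κ r F x v)).trans ?_
  rw [← Set.image_univ]
  refine (Set.encard_image_le _ _).trans ?_
  rw [Set.encard_univ, ENat.card_eq_coe_natCard]

/-- The back-and-forth step for a first-order quantifier. -/
theorem JointEq.exists_update (h : JointEq k (3 * r) F c c' v v')
    (hc : CountEq k r (Nat.card (F × {u : List Move // u.length ≤ r}) + 1) c c') (x i : ℕ) :
    ∃ i', JointEq k r (insert x F) c c' (Function.update v x i) (Function.update v' x i') := by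
  by_cases hi : Near (k ∘ c) r F x v i
  · obtain ⟨y, hy, hyx, u, hu, hi⟩ := hi
    obtain ⟨i', -, h'⟩ := h.near hy hyx hu hi
    exact ⟨i', h'⟩
  by_contra hno
  set t := localType r k c i with ht
  set T := {j | localType r k c j ∈ ({t} : Set (LocalType r C))} with hT
  set T' := {j | localType r k c' j ∈ ({t} : Set (LocalType r C))} with hT'
  have hnear : ∀ j ∈ T', Near (k ∘ c') r F x v' j := by
    intro j hj
    by_contra hfar
    exact hno ⟨j, (h.mono (by omega) subset_rfl).far (ht.symm.trans (Eq.symm hj)) hi hfar⟩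
  have hback : ∀ j' ∈ T', ∃ j, j ∈ T \ {i} ∧ ∃ y ∈ F, ∃ u : List Move, u.length ≤ r ∧
      walk (k ∘ c) u (v y) = some j ∧ walk (k ∘ c') u (v' y) = some j' := by
    intro j' hj'
    obtain ⟨y, hy, hyx, u, hu, hw⟩ := hnear j' hj'
    obtain ⟨j, hj, hJ⟩ := h.symm.near hy hyx hu hw
    have := hJ.localType_eq (Finset.mem_insert_self x F)
    simp only [Function.update_self] at this
    refine ⟨j, ⟨this.symm.trans hj', ?_⟩, y, hy, u, hu, hj, hw⟩
    rintro rfl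
    exact hi ⟨y, hy, hyx, u, hu, hj⟩
  choose! g hg hgw using hback
  have hinj : Set.InjOn g T' := by
    intro j₁ h₁ j₂ h₂ heq
    obtain ⟨y₁, hy₁, u₁, hu₁, e₁, e₁'⟩ := hgw j₁ h₁
    obtain ⟨y₂, hy₂, u₂, hu₂, e₂, e₂'⟩ := hgw j₂ h₂
    rw [heq, walk_eq_some_iff_append_invWord e₂, (h y₁ hy₁ _ (by simp; omega)).2 y₂ hy₂,
      ← walk_eq_some_iff_append_invWord e₂', e₁'] at e₁
    exact Option.some.inj e₁
  have hle : T'.encard + 1 ≤ T.encard := by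
    rw [← Set.encard_sdiff_singleton_add_one (show i ∈ T from rfl)]
    exact add_le_add (Set.encard_le_encard_of_injOn (fun j hj => hg j hj) hinj) le_rfl
  have hbound : T'.encard ≤ Nat.card (F × {u : List Move // u.length ≤ r}) :=
    (Set.encard_le_encard hnear).trans (encard_near_le _ _ _ _ _)
  have hcount := (hc {t}).1
  rw [← hT, ← hT'] at hcount
  obtain ⟨m, hm⟩ := ENat.ne_top_iff_exists.1 (ne_top_of_le_ne_top (ENat.natCast_ne_top _) hbound)
  rw [← hm] at hle hbound hcount
  have hlt : ((m : ℕ∞) + 1) ≤ min T.encard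
      ((Nat.card (F × {u : List Move // u.length ≤ r}) + 1 : ℕ) : ℕ∞) := by
    refine le_min hle ?_
    have : m ≤ Nat.card (F × {u : List Move // u.length ≤ r}) := by exact_mod_cast hbound
    exact_mod_cast Nat.succ_le_succ this
  rw [hcount] at hlt
  have := hlt.trans (min_le_left _ _)
  have : m + 1 ≤ m := by exact_mod_cast this
  omega

/-- The back-and-forth step for the infinity quantifier: all but finitely many positions are far
from those of the other variables, and infinitely many of them have the same local type. -/
theorem JointEq.infinite_update [Finite C] (h : JointEq k r F c c' v v') (hc : CountEq k r n c c')
    (x : ℕ) {P P' : ℕ → Prop} (hP : {i | P i}.Infinite)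
    (hPP' : ∀ i i', JointEq k r (insert x F) c c' (Function.update v x i)
      (Function.update v' x i') → P i → P' i') : {i | P' i}.Infinite := by
  have hfar := hP.sdiff (near_finite (k ∘ c) r F x v)
  obtain ⟨t, ht⟩ : ∃ t, {i | i ∈ {i | P i} \ {i | Near (k ∘ c) r F x v i} ∧
      localType r k c i = t}.Infinite := by
    by_contra! hno
    refine hfar ((Set.finite_iUnion fun t => hno t).subset fun i hi => ?_)
    exact Set.mem_iUnion.2 ⟨_, hi, rfl⟩
  have hinf := (hc {t}).2.1 (ht.mono fun i hi => hi.2)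
  obtain ⟨i, hi, hit⟩ := ht.nonempty
  refine (hinf.sdiff (near_finite (k ∘ c') r F x v')).mono fun i' hi' => ?_
  exact hPP' i i' (h.far (hit.trans (Eq.symm hi'.1)) hi.2 hi'.2) hi.1

end Hanf

/-- Satisfaction in the nested word whose letters and sets are read off a labelling `c`. -/
def SatLabel {C : Type*} (S : CallReturnAlphabet K A) (ltr : C → A) (sets : C → Set ℕ)
    (c : ℕ → C) (v : ℕ → ℕ) (φ : Formula A) : Prop :=
  φ.Sat (nested S (ltr ∘ c)) v fun X => {i | X ∈ sets (c i)}

/-- The truth of a first-order formula with infinity quantifiers depends only on the joint local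
type of the free variables and on the numbers of occurrences of local types, up to some threshold
and infinity. -/
theorem exists_radius_threshold {C : Type*} [Finite C] (S : CallReturnAlphabet K A) (ltr : C → A)
    (sets : C → Set ℕ) (φ : Formula A) (hφ : φ.IsFO) (F : Finset ℕ) (hF : φ.freeVars ⊆ F) :
    ∃ r n, ∀ c c' v v', CountEq (S.kind ∘ ltr) r n c c' → JointEq (S.kind ∘ ltr) r F c c' v v' →
      (SatLabel S ltr sets c v φ ↔ SatLabel S ltr sets c' v' φ) := by
  have hlab : ∀ {r : ℕ} {F : Finset ℕ} {c c' : ℕ → C} {v v' : ℕ → ℕ} {x : ℕ},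
      JointEq (S.kind ∘ ltr) r F c c' v v' → x ∈ F → c (v x) = c' (v' x) := by
    intro r F c c' v v' x h hx
    simpa using (h x hx [] (Nat.zero_le _)).1
  induction φ generalizing F with
  | label x a =>
    refine ⟨0, 0, fun c c' v v' _ h => ?_⟩
    have := hlab h (hF (by simp [Formula.freeVars]) : x ∈ F)
    simp only [SatLabel, Formula.Sat, nested, Function.comp_apply, this]
  | succ x y =>
    refine ⟨1, 0, fun c c' v v' _ h => ?_⟩
    have := (h x (hF (by simp [Formula.freeVars])) [.succ] le_rfl).2 y
      (hF (by simp [Formula.freeVars]))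
    rwa [walk_singleton, walk_singleton, mv_succ, mv_succ] at this
  | mu x y =>
    refine ⟨1, 0, fun c c' v v' _ h => ?_⟩
    have h1 := (h x (hF (by simp [Formula.freeVars])) [.arc] le_rfl).2 y
      (hF (by simp [Formula.freeVars]))
    have h2 := hlab h (hF (by simp [Formula.freeVars]) : x ∈ F)
    rw [walk_singleton, walk_singleton, mv_arc, mv_arc] at h1
    have key : ∀ (c : ℕ → C) (i j : ℕ), (∃ s, Matching S (ltr ∘ c) s i j) ↔
        Partner ((S.kind ∘ ltr) ∘ c) i j ∧ ∃ s, S.kind (ltr (c i)) = .call s := by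
      intro c i j
      simp only [matching_iff_matched]
      constructor
      · rintro ⟨s, hs⟩
        exact ⟨⟨s, .inl hs⟩, s, hs.call⟩
      · rintro ⟨⟨s, hs | hs⟩, t, ht⟩
        · exact ⟨s, hs⟩
        · exact absurd (ht.symm.trans hs.ret) (by simp)
    change (∃ s, Matching S (ltr ∘ c) s (v x) (v y)) ↔ ∃ s, Matching S (ltr ∘ c') s (v' x) (v' y)
    rw [key, key, h1, h2]
  | eq x y =>
    refine ⟨0, 0, fun c c' v v' _ h => ?_⟩
    have := (h x (hF (by simp [Formula.freeVars])) [] le_rfl).2 y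
      (hF (by simp [Formula.freeVars]))
    simpa [SatLabel, Formula.Sat] using this
  | mem x X =>
    refine ⟨0, 0, fun c c' v v' _ h => ?_⟩
    have := hlab h (hF (by simp [Formula.freeVars]) : x ∈ F)
    simp only [SatLabel, Formula.Sat, Set.mem_ofPred_eq, this]
  | not φ ih =>
    obtain ⟨r, n, h⟩ := ih hφ F hF
    exact ⟨r, n, fun c c' v v' h1 h2 => not_congr (h c c' v v' h1 h2)⟩
  | or φ ψ ih1 ih2 =>
    obtain ⟨r, n, h⟩ := ih1 hφ.1 F (Set.subset_union_left.trans hF)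
    obtain ⟨r', n', h'⟩ := ih2 hφ.2 F (Set.subset_union_right.trans hF)
    refine ⟨max r r', max n n', fun c c' v v' h1 h2 => or_congr (h c c' v v' ?_ ?_)
      (h' c c' v v' ?_ ?_)⟩
    · exact h1.mono (le_max_left _ _) (le_max_left _ _)
    · exact h2.mono (le_max_left _ _) subset_rfl
    · exact h1.mono (le_max_right _ _) (le_max_right _ _)
    · exact h2.mono (le_max_right _ _) subset_rfl
  | ex x φ ih =>
    obtain ⟨r, n, h⟩ := ih hφ (insert x F) (by
      intro y hy
      by_cases hyx : y = x
      · simp [hyx]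
      · simpa [hyx] using hF ⟨hy, hyx⟩)
    have main : ∀ c c' v v',
        CountEq (S.kind ∘ ltr) (3 * r)
          (max n (Nat.card (F × {u : List Move // u.length ≤ r}) + 1)) c c' →
        JointEq (S.kind ∘ ltr) (3 * r) F c c' v v' →
        SatLabel S ltr sets c v (.ex x φ) → SatLabel S ltr sets c' v' (.ex x φ) := by
      rintro c c' v v' h1 h2 ⟨i, hi⟩
      obtain ⟨i', hi'⟩ := h2.exists_update (h1.mono (by omega) (le_max_right _ _)) x i
      exact ⟨i', (h _ _ _ _ (h1.mono (by omega) (le_max_left _ _)) hi').1 hi⟩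
    exact ⟨_, _, fun c c' v v' h1 h2 => ⟨main c c' v v' h1 h2, main c' c v' v h1.symm h2.symm⟩⟩
  | exInf x φ ih =>
    obtain ⟨r, n, h⟩ := ih hφ (insert x F) (by
      intro y hy
      by_cases hyx : y = x
      · simp [hyx]
      · simpa [hyx] using hF ⟨hy, hyx⟩)
    have main : ∀ c c' v v', CountEq (S.kind ∘ ltr) r n c c' →
        JointEq (S.kind ∘ ltr) r F c c' v v' →
        SatLabel S ltr sets c v (.exInf x φ) → SatLabel S ltr sets c' v' (.exInf x φ) := by
      intro c c' v v' h1 h2 hinf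
      exact h2.infinite_update h1 x hinf fun i i' hJ => (h _ _ _ _ h1 hJ).1
    exact ⟨_, _, fun c c' v v' h1 h2 => ⟨main c c' v v' h1 h2, main c' c v' v h1.symm h2.symm⟩⟩
  | exSet X φ => exact hφ.elim

/-! ### From formulas to automata -/

theorem InfNestedWord.exists_eq_nested {S : CallReturnAlphabet K A} (W : InfNestedWord S) :
    ∃ w, W = nested S w := by
  obtain ⟨succ, mu, lam, h1, h2⟩ := W
  refine ⟨lam, ?_⟩
  simp only [nested, InfNestedWord.mk.injEq, and_true]
  exact ⟨funext fun i => funext fun j => propext (h1 i j),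
    funext fun i => funext fun j => propext (h2 i j)⟩

section FormulaToAutomaton

/-- The truth of a formula depends only on the interpretation of its free variables. -/
theorem Formula.sat_congr {S : CallReturnAlphabet K A} (W : InfNestedWord S) (φ : Formula A)
    {v v' : ℕ → ℕ} {V V' : ℕ → Set ℕ} (hv : ∀ x ∈ φ.freeVars, v x = v' x)
    (hV : ∀ X ∈ φ.freeSetVars, V X = V' X) : φ.Sat W v V ↔ φ.Sat W v' V' := by
  induction φ generalizing v v' V V' with
  | label x a => simp only [Sat, hv x (by simp [freeVars])]
  | succ x y => simp only [Sat, hv x (by simp [freeVars]), hv y (by simp [freeVars])]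
  | mu x y => simp only [Sat, hv x (by simp [freeVars]), hv y (by simp [freeVars])]
  | eq x y => simp only [Sat, hv x (by simp [freeVars]), hv y (by simp [freeVars])]
  | mem x X => simp only [Sat, hv x (by simp [freeVars]), hV X (by simp [freeSetVars])]
  | not φ ih => exact not_congr (ih hv hV)
  | or φ ψ ih1 ih2 =>
    exact or_congr (ih1 (fun x hx => hv x (.inl hx)) fun X hX => hV X (.inl hX))
      (ih2 (fun x hx => hv x (.inr hx)) fun X hX => hV X (.inr hX))
  | ex x φ ih =>
    refine exists_congr fun i => ih (fun y hy => ?_) hV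
    by_cases hyx : y = x
    · subst hyx; simp
    · simp [hyx, hv y ⟨hy, hyx⟩]
  | exInf x φ ih =>
    have : ∀ i, φ.Sat W (Function.update v x i) V ↔ φ.Sat W (Function.update v' x i) V' := by
      refine fun i => ih (fun y hy => ?_) hV
      by_cases hyx : y = x
      · subst hyx; simp
      · simp [hyx, hv y ⟨hy, hyx⟩]
    simp only [Sat, this]
  | exSet X φ ih =>
    refine exists_congr fun I => ih hv fun Y hY => ?_
    by_cases hYX : Y = X
    · subst hYX; simp
    · simp [hYX, hV Y ⟨hY, hYX⟩]

/-- Over labellings that carry the letters of the nested word and the interpretation of the first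
`N` set variables, existential second-order sentences define recognizable properties. -/
theorem recognizable_of_isEMSO {B : Type} [Finite B] (S : CallReturnAlphabet 2 A) (ltr : B → A)
    (v : ℕ → ℕ) {φ : Formula A} (hφ : φ.IsEMSO) (hfree : φ.freeVars = ∅) :
    ∃ N₀, ∀ N ≥ N₀, Recognizable (C := B × Set (Fin N)) (S.kind ∘ ltr ∘ Prod.fst) fun c =>
      SatLabel S (ltr ∘ Prod.fst) (fun b => {X | ∃ h : X < N, ⟨X, h⟩ ∈ b.2}) c v φ := by
  induction hφ with
  | base φ hFO =>
    refine ⟨0, fun N _ => ?_⟩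
    obtain ⟨r, n, h⟩ := exists_radius_threshold S (ltr ∘ Prod.fst)
      (fun b : B × Set (Fin N) => {X | ∃ h : X < N, ⟨X, h⟩ ∈ b.2}) φ hFO ∅ (by simp [hfree])
    exact recognizable_of_countEq _ r n fun c c' hc =>
      (h c c' v v hc fun x hx => absurd hx (Finset.notMem_empty x)).1
  | exSet X φ _ ih =>
    obtain ⟨N₀, ih⟩ := ih hfree
    refine ⟨max N₀ (X + 1), fun N hN => ?_⟩
    have hXN : X < N := by omega
    let f : (B × Set (Fin N)) × Prop → B × Set (Fin N) := fun b =>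
      (b.1.1, {Y | if (Y : ℕ) = X then b.2 else Y ∈ b.1.2})
    have h := ((ih N (by omega)).comap (k := (S.kind ∘ ltr ∘ Prod.fst) ∘ Prod.fst) f rfl).ex
    refine h.congr fun c => ?_
    have key : ∀ I : Set ℕ, SatLabel S (ltr ∘ Prod.fst)
        (fun b : B × Set (Fin N) => {X | ∃ h : X < N, ⟨X, h⟩ ∈ b.2})
        (f ∘ fun i => (c i, i ∈ I)) v φ ↔
        φ.Sat (nested S ((ltr ∘ Prod.fst) ∘ c)) v
          (Function.update (fun X => {i | ∃ h : X < N, ⟨X, h⟩ ∈ (c i).2}) X I) := by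
      intro I
      refine iff_of_eq (congrArg (fun V => φ.Sat (nested S ((ltr ∘ Prod.fst) ∘ c)) v V) ?_)
      funext Y
      by_cases hY : Y = X
      · subst hY
        ext i
        simp [f, hXN]
      · ext i
        simp [f, hY]
    constructor
    · rintro ⟨δ, hδ⟩
      exact ⟨{i | δ i}, (key {i | δ i}).1 hδ⟩
    · rintro ⟨I, hI⟩
      exact ⟨fun i => i ∈ I, (key I).2 hI⟩

theorem exists_automaton_of_isEMSO [Finite A] (S : CallReturnAlphabet 2 A) {φ : Formula A}
    (hs : φ.IsSentence) (hφ : φ.IsEMSO) : ∃ M : BuchiMVPA S, M.language = φ.language S := by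
  obtain ⟨n, ⟨e⟩⟩ := Finite.exists_equiv_fin A
  obtain ⟨N, hN⟩ := recognizable_of_isEMSO S e.symm (fun _ => 0) hφ hs.1
  obtain ⟨D, hD, T, hT⟩ := (hN N le_rfl).comap (k := S.kind ∘ e.symm) (fun b => (b, ∅)) rfl
  refine ⟨T.automaton S (e.symm ∘ Prod.fst), Set.ext fun W => ?_⟩
  obtain ⟨w, rfl⟩ := W.exists_eq_nested
  have hacc : ∀ w : ℕ → A, w ∈ (T.automaton S (e.symm ∘ Prod.fst)).stringLanguage ↔
      φ.Sat (nested S w) (fun _ => 0) fun _ => ∅ := by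
    intro w
    rw [Tiling.mem_automaton_iff]
    have h := hT (e ∘ w)
    have e1 : ((e.symm ∘ Prod.fst) ∘ (fun b => (b, ∅) : Fin n → Fin n × Set (Fin N)) ∘ e ∘ w) =
        w := by
      funext i; simp
    have e2 : (fun X => {i | X ∈ {X | ∃ h : X < N, (⟨X, h⟩ : Fin N) ∈
        (((fun b => (b, ∅) : Fin n → Fin n × Set (Fin N)) ∘ e ∘ w) i).2}}) =
        fun _ => (∅ : Set ℕ) := by
      funext X; simp
    simp only [SatLabel, e1, e2] at h
    rw [h]
    constructor
    · rintro ⟨x, rfl, hx⟩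
      refine ⟨fun i => (x i).2, ?_⟩
      have hx' : (fun i => ((e ∘ (e.symm ∘ Prod.fst) ∘ x) i, (x i).2)) = x := by
        funext i; simp
      rw [hx']
      exact hx
    · rintro ⟨δ, hδ⟩
      exact ⟨_, by funext i; simp, hδ⟩
  have hsat : nested S w ∈ φ.language S ↔
      φ.Sat (nested S w) (fun _ => 0) fun _ => ∅ :=
    ⟨fun h => h _ _, fun h v V => (φ.sat_congr _ (by simp [hs.1]) (by simp [hs.2])).1 h⟩
  rw [hsat]
  constructor
  · rintro ⟨w', hw, he⟩
    rw [← he]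
    exact (hacc w').1 hw
  · exact fun h => ⟨w, (hacc w).2 h, rfl⟩

end FormulaToAutomaton

/-! ### From automata to formulas -/

namespace Formula

/-- `φ ∧ ψ` -/
def and (φ ψ : Formula A) : Formula A := not (or (not φ) (not ψ))

/-- `∀ x φ` -/
def all (x : ℕ) (φ : Formula A) : Formula A := not (ex x (not φ))

/-- The disjunction of a list of formulas. -/
def orList : List (Formula A) → Formula A
  | [] => not (ex 0 (eq 0 0))
  | φ :: l => or φ (orList l)

/-- The disjunction of a finite family of formulas. -/
noncomputable def orOver {ι : Type*} [Finite ι] (f : ι → Formula A) : Formula A :=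
  orList (((@Finset.univ ι (Fintype.ofFinite ι)).toList).map f)

/-- `∃ X₀ … ∃ Xₙ₋₁ φ` -/
def exSets (φ : Formula A) : ℕ → Formula A
  | 0 => φ
  | n + 1 => exSet n (exSets φ n)

section Semantics

variable {S : CallReturnAlphabet K A} {W : InfNestedWord S} {v : ℕ → ℕ} {V : ℕ → Set ℕ}

theorem sat_and {φ ψ : Formula A} : (and φ ψ).Sat W v V ↔ φ.Sat W v V ∧ ψ.Sat W v V := by
  simp [and, Sat]

theorem sat_all {x : ℕ} {φ : Formula A} :
    (all x φ).Sat W v V ↔ ∀ i, φ.Sat W (Function.update v x i) V := by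
  simp [all, Sat]

theorem sat_orList {l : List (Formula A)} : (orList l).Sat W v V ↔ ∃ φ ∈ l, φ.Sat W v V := by
  induction l with
  | nil => simp [orList, Sat]
  | cons φ l ih => simp [orList, Sat, ih]

theorem sat_orOver {ι : Type*} [Finite ι] {f : ι → Formula A} :
    (orOver f).Sat W v V ↔ ∃ i, (f i).Sat W v V := by
  simp [orOver, sat_orList]

theorem sat_exSets {φ : Formula A} {n : ℕ} : (exSets φ n).Sat W v V ↔
    ∃ V' : ℕ → Set ℕ, (∀ X ≥ n, V' X = V X) ∧ φ.Sat W v V' := by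
  induction n generalizing V with
  | zero =>
    constructor
    · exact fun h => ⟨V, fun _ _ => rfl, h⟩
    · rintro ⟨V', h, h'⟩
      obtain rfl : V' = V := funext fun X => h X (Nat.zero_le _)
      exact h'
  | succ n ih =>
    simp only [exSets, Sat, ih]
    constructor
    · rintro ⟨I, V', h, h'⟩
      refine ⟨V', fun X hX => ?_, h'⟩
      rw [h X (by omega), Function.update_of_ne (by omega)]
    · rintro ⟨V', h, h'⟩
      refine ⟨V' n, V', fun X hX => ?_, h'⟩
      rcases hX.lt_or_eq with hX | rfl
      · rw [Function.update_of_ne (by omega), h X hX]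
      · simp

end Semantics

/-- `φ` is a first-order formula with free first-order variables in `s` and free set variables below
`n`. -/
structure Within (s : Set ℕ) (n : ℕ) (φ : Formula A) : Prop where
  isFO : φ.IsFO
  vars : φ.freeVars ⊆ s
  setVars : φ.freeSetVars ⊆ Set.Iio n

namespace Within

variable {s : Set ℕ} {n : ℕ} {φ ψ : Formula A}

theorem label {x : ℕ} {a : A} (hx : x ∈ s) : Within s n (.label x a) :=
  ⟨trivial, by simpa [freeVars] using hx, by simp [freeSetVars]⟩

theorem succ {x y : ℕ} (hx : x ∈ s) (hy : y ∈ s) : Within s n (.succ x y : Formula A) :=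
  ⟨trivial, by simp [freeVars, Set.insert_subset_iff, hx, hy], by simp [freeSetVars]⟩

theorem mu {x y : ℕ} (hx : x ∈ s) (hy : y ∈ s) : Within s n (.mu x y : Formula A) :=
  ⟨trivial, by simp [freeVars, Set.insert_subset_iff, hx, hy], by simp [freeSetVars]⟩

theorem eq {x y : ℕ} (hx : x ∈ s) (hy : y ∈ s) : Within s n (.eq x y : Formula A) :=
  ⟨trivial, by simp [freeVars, Set.insert_subset_iff, hx, hy], by simp [freeSetVars]⟩

theorem mem {x : ℕ} (hx : x ∈ s) (X : Fin n) : Within s n (.mem x X : Formula A) :=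
  ⟨trivial, by simpa [freeVars] using hx, by simp [freeSetVars]⟩

theorem not (h : Within s n φ) : Within s n (.not φ) := ⟨h.isFO, h.vars, h.setVars⟩

theorem or (h : Within s n φ) (h' : Within s n ψ) : Within s n (.or φ ψ) :=
  ⟨⟨h.isFO, h'.isFO⟩, Set.union_subset h.vars h'.vars, Set.union_subset h.setVars h'.setVars⟩

theorem and (h : Within s n φ) (h' : Within s n ψ) : Within s n (.and φ ψ) := (h.not.or h'.not).not

theorem ex {x : ℕ} (h : Within (insert x s) n φ) : Within s n (.ex x φ) :=
  ⟨h.isFO, Set.sdiff_singleton_subset_iff.2 h.vars, h.setVars⟩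

theorem exInf {x : ℕ} (h : Within (insert x s) n φ) : Within s n (.exInf x φ) :=
  ⟨h.isFO, Set.sdiff_singleton_subset_iff.2 h.vars, h.setVars⟩

theorem all {x : ℕ} (h : Within (insert x s) n φ) : Within s n (.all x φ) := h.not.ex.not

theorem orOver {ι : Type*} [Finite ι] {f : ι → Formula A} (h : ∀ i, Within s n (f i)) :
    Within s n (.orOver f) := by
  unfold Formula.orOver
  induction (@Finset.univ ι (Fintype.ofFinite ι)).toList with
  | nil => exact ⟨trivial, by simp [orList, freeVars], by simp [orList, freeSetVars]⟩
  | cons a l ih => exact (h a).or ih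

theorem isSentence_exSets (h : Within ∅ n φ) : (exSets φ n).IsSentence := by
  have h1 : ∀ m, (exSets φ m).freeVars = φ.freeVars := by
    intro m
    induction m with
    | zero => rfl
    | succ m ih => exact ih
  have h2 : ∀ m, (exSets φ m).freeSetVars = φ.freeSetVars \ Set.Iio m := by
    intro m
    induction m with
    | zero => simp [exSets]
    | succ m ih =>
      simp only [exSets, freeSetVars, ih]
      ext X
      simp only [Set.mem_sdiff, Set.mem_Iio, Set.mem_singleton_iff]
      have : X < m + 1 ↔ X < m ∨ X = m := by omega
      rw [this]
      tauto
  exact ⟨by rw [h1]; exact Set.subset_empty_iff.1 h.vars,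
    by rw [h2]; exact Set.sdiff_eq_empty.2 h.setVars⟩

theorem isEMSO_exSets (h : Within s n φ) (m : ℕ) : (exSets φ m).IsEMSO := by
  induction m with
  | zero => exact .base φ h.isFO
  | succ m ih => exact .exSet m _ ih

end Within

end Formula

section AutomatonToFormula

open Formula

variable {S : CallReturnAlphabet K A} (M : BuchiMVPA S) {n : ℕ}
  (idx : M.State × M.Stack ≃ Fin n)

instance : Finite M.State := M.finite_state

instance : Finite M.Stack := M.finite_stack

namespace BuchiMVPA

/-- The automaton has a transition from `t.1` to `t.2.2` reading the letter `t.2.1` at the position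
denoted by the variable `0`. A state is paired with the symbol that is pushed if the letter is a
call; the symbol popped by a return is found at the matching call, denoted by the variable `2`. -/
noncomputable def transFormula (t : (M.State × M.Stack) × A × (M.State × M.Stack)) : Formula A :=
  or (orOver fun _ : {_u : Unit // (t.1.1, t.2.1, t.1.2, t.2.2.1) ∈ M.callTrans ∨
      (t.1.1, t.2.1, t.2.2.1) ∈ M.intTrans} => eq 0 0)
    (or (orOver fun e : {e : M.State × M.Stack // (t.1.1, t.2.1, e.2, t.2.2.1) ∈ M.retTrans} =>
        ex 2 (Formula.and (mu 2 0) (mem 2 (idx e))))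
      (orOver fun _ : {_u : Unit // (t.1.1, t.2.1, M.bot, t.2.2.1) ∈ M.retTrans} =>
        not (ex 2 (mu 2 0))))

/-- The first-order formula saying that the set variables describe an accepting run: the set with
index `idx (q, B)` consists of the positions that are read in state `q` and at which `B` is pushed
in the case of a call. -/
noncomputable def runFormula [Finite A] : Formula A :=
  Formula.and (all 0 (orOver fun e => mem 0 (idx e))) <|
  Formula.and (all 0 (not (orOver fun p : {p : (M.State × M.Stack) × (M.State × M.Stack) //
    p.1 ≠ p.2} => Formula.and (mem 0 (idx p.1.1)) (mem 0 (idx p.1.2))))) <|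
  Formula.and (all 0 (or (ex 1 (succ 1 0))
    (orOver fun e : {e : M.State × M.Stack // e.1 ∈ M.init} => mem 0 (idx e)))) <|
  Formula.and (all 0 (all 1 (or (not (succ 0 1)) (orOver fun
    t : (M.State × M.Stack) × A × (M.State × M.Stack) =>
      Formula.and (mem 0 (idx t.1)) (Formula.and (label 0 t.2.1) (Formula.and (mem 1 (idx t.2.2))
        (M.transFormula idx t))))))) <|
  exInf 0 (orOver fun e : {e : M.State × M.Stack // e.1 ∈ M.final} => mem 0 (idx e))

theorem within_runFormula [Finite A] : Within ∅ n (M.runFormula idx) := by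
  refine .and (.all (.orOver fun e => .mem (by simp) _)) <|
    .and (.all (.not (.orOver fun p => .and (.mem (by simp) _) (.mem (by simp) _)))) <|
    .and (.all (.or (.ex (.succ (by simp) (by simp))) (.orOver fun e => .mem (by simp) _))) <|
    .and (.all (.all (.or (.not (.succ (by simp) (by simp))) (.orOver fun t =>
      .and (.mem (by simp) _) (.and (.label (by simp)) (.and (.mem (by simp) _) ?_)))))) <|
    .exInf (.orOver fun e => .mem (by simp) _)
  exact .or (.orOver fun _ => .eq (by simp) (by simp)) (.or (.orOver fun e => .ex
    (.and (.mu (by simp) (by simp)) (.mem (by simp) _))) (.orOver fun _ => .not (.ex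
      (.mu (by simp) (by simp)))))

theorem sat_runFormula [Finite A] (w : ℕ → A) (v : ℕ → ℕ) (V : ℕ → Set ℕ) :
    (M.runFormula idx).Sat (nested S w) v V ↔ ∃ ρ : ℕ → M.State × M.Stack,
      (∀ i e, i ∈ V (idx e) ↔ ρ i = e) ∧ (ρ 0).1 ∈ M.init ∧
      (∀ i, ((ρ i).1, w i, (ρ i).2, (ρ (i + 1)).1) ∈ M.callTrans ∨
        ((ρ i).1, w i, (ρ (i + 1)).1) ∈ M.intTrans ∨
        (∃ p s, Matched (S.kind ∘ w) s p i ∧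
          ((ρ i).1, w i, (ρ p).2, (ρ (i + 1)).1) ∈ M.retTrans) ∨
        ((ρ i).1, w i, M.bot, (ρ (i + 1)).1) ∈ M.retTrans ∧
          ∀ p s, ¬ Matched (S.kind ∘ w) s p i) ∧
      {i | (ρ i).1 ∈ M.final}.Infinite := by
  simp only [runFormula, transFormula, sat_and, sat_all, sat_orOver, Sat, nested,
    matching_iff_matched, Function.update_self, ne_eq, OfNat.zero_ne_ofNat,
    zero_ne_one, not_false_eq_true, Function.update_of_ne]
  constructor
  · rintro ⟨h1, h2, h3, h4, h5⟩
    choose ρ hρ using h1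
    have hmem : ∀ i e, i ∈ V (idx e) ↔ ρ i = e := by
      refine fun i e => ⟨fun h => ?_, fun h => h ▸ hρ i⟩
      by_contra hne
      exact h2 i ⟨⟨(ρ i, e), hne⟩, hρ i, h⟩
    simp only [hmem] at h3 h4 h5
    refine ⟨ρ, hmem, ?_, fun i => ?_, ?_⟩
    · rcases h3 0 with ⟨j, hj⟩ | ⟨e, he⟩
      · omega
      · rw [he]; exact e.2
    · rcases h4 i (i + 1) with h | ⟨⟨e, a, e'⟩, he, ha, he', h⟩
      · exact absurd rfl h
      · simp only at he ha he'
        subst he ha he'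
        rcases h with ⟨⟨_, h | h⟩, -⟩ | ⟨⟨e, he⟩, p, ⟨s, hs⟩, hp⟩ | ⟨⟨_, h⟩, h'⟩
        · exact .inl h
        · exact .inr (.inl h)
        · simp only at hp
          subst hp
          exact .inr (.inr (.inl ⟨p, s, hs, he⟩))
        · exact .inr (.inr (.inr ⟨h, fun p s hs => h' ⟨p, s, hs⟩⟩))
    · refine h5.mono fun i hi => ?_
      obtain ⟨e, he⟩ := hi
      change (ρ i).1 ∈ M.final
      rw [he]
      exact e.2
  · rintro ⟨ρ, hmem, h0, hstep, hF⟩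
    simp only [hmem]
    refine ⟨fun i => ⟨ρ i, rfl⟩, ?_, ?_, ?_, ?_⟩
    · rintro i ⟨⟨p, hp⟩, h, h'⟩
      exact hp (h.symm.trans h')
    · rintro (_ | i)
      · exact .inr ⟨⟨ρ 0, h0⟩, rfl⟩
      · exact .inl ⟨i, rfl⟩
    · intro i j
      by_cases hj : j = i + 1
      · subst hj
        refine .inr ⟨(ρ i, w i, ρ (i + 1)), rfl, rfl, rfl, ?_⟩
        rcases hstep i with h | h | ⟨p, s, hs, h⟩ | ⟨h, h'⟩
        · exact .inl ⟨⟨(), .inl h⟩, trivial⟩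
        · exact .inl ⟨⟨(), .inr h⟩, trivial⟩
        · exact .inr (.inl ⟨⟨ρ p, h⟩, p, ⟨s, hs⟩, rfl⟩)
        · exact .inr (.inr ⟨⟨(), h⟩, fun ⟨p, s, hs⟩ => h' p s hs⟩)
      · exact .inl hj
    · exact hF.mono fun i hi => ⟨⟨ρ i, hi⟩, rfl⟩

/-- Acceptance, with a state and a pushed symbol for every position. -/
theorem mem_stringLanguage_iff_exists_labelling (w : ℕ → A) :
    w ∈ M.stringLanguage ↔ ∃ ρ : ℕ → M.State × M.Stack, (ρ 0).1 ∈ M.init ∧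
      (∀ i, ((ρ i).1, w i, (ρ i).2, (ρ (i + 1)).1) ∈ M.callTrans ∨
        ((ρ i).1, w i, (ρ (i + 1)).1) ∈ M.intTrans ∨
        (∃ p s, Matched (S.kind ∘ w) s p i ∧
          ((ρ i).1, w i, (ρ p).2, (ρ (i + 1)).1) ∈ M.retTrans) ∨
        ((ρ i).1, w i, M.bot, (ρ (i + 1)).1) ∈ M.retTrans ∧
          ∀ p s, ¬ Matched (S.kind ∘ w) s p i) ∧
      {i | (ρ i).1 ∈ M.final}.Infinite := by
  rw [M.mem_stringLanguage_iff]
  constructor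
  · rintro ⟨q, B, h0, hc, hm, hu, hi, hF⟩
    refine ⟨fun i => (q i, B i), h0, fun i => ?_, hF⟩
    match hk : S.kind (w i) with
    | .call s => exact .inl (hc i s hk)
    | .int => exact .inr (.inl (hi i hk))
    | .ret s =>
      by_cases hp : pending (S.kind ∘ w) s i = []
      · refine .inr (.inr (.inr ⟨hu i s hk hp, fun p t ht => ?_⟩))
        obtain rfl : s = t := by
          have := hk.symm.trans ht.ret
          simpa using this
        exact ht.pending_ne_nil hp
      · obtain ⟨p, hp⟩ := exists_matched_of_ret (κ := S.kind ∘ w) hk hp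
        exact .inr (.inr (.inl ⟨p, s, hp, hm p i s hp⟩))
  · rintro ⟨ρ, h0, hstep, hF⟩
    -- the letter determines which of the four kinds of transitions is taken
    have hcall : ∀ {i s}, S.kind (w i) = .call s →
        ((ρ i).1, w i, (ρ i).2, (ρ (i + 1)).1) ∈ M.callTrans := by
      intro i s hk
      rcases hstep i with h | h | ⟨p, t, -, h⟩ | ⟨h, -⟩
      · exact h
      · exact absurd (hk.symm.trans (M.intTrans_spec _ _ _ h)) (by simp)
      · obtain ⟨t, ht⟩ := M.retTrans_spec _ _ _ _ h
        exact absurd (hk.symm.trans ht) (by simp)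
      · obtain ⟨t, ht⟩ := M.retTrans_spec _ _ _ _ h
        exact absurd (hk.symm.trans ht) (by simp)
    have hret : ∀ {i s}, S.kind (w i) = .ret s → (∃ p s, Matched (S.kind ∘ w) s p i ∧
          ((ρ i).1, w i, (ρ p).2, (ρ (i + 1)).1) ∈ M.retTrans) ∨
        ((ρ i).1, w i, M.bot, (ρ (i + 1)).1) ∈ M.retTrans ∧
          ∀ p s, ¬ Matched (S.kind ∘ w) s p i := by
      intro i s hk
      rcases hstep i with h | h | h
      · obtain ⟨t, ht⟩ := (M.callTrans_spec _ _ _ _ h).1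
        exact absurd (hk.symm.trans ht) (by simp)
      · exact absurd (hk.symm.trans (M.intTrans_spec _ _ _ h)) (by simp)
      · exact h
    refine ⟨fun i => (ρ i).1, fun i => (ρ i).2, h0, fun i s hk => hcall hk, ?_, ?_, ?_, hF⟩
    · intro i j s hm
      rcases hret hm.ret with ⟨p, t, ht, h⟩ | ⟨-, h⟩
      · obtain rfl : p = i := by
          have h1 : Partner (S.kind ∘ w) j p := ⟨t, .inr ht⟩
          exact h1.unique ⟨s, .inr hm⟩
        exact h
      · exact absurd hm (h i s)
    · intro j s hk hp
      rcases hret hk with ⟨p, t, ht, -⟩ | ⟨h, -⟩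
      · obtain rfl : t = s := by
          have := ht.ret.symm.trans hk
          simpa using this
        exact absurd hp ht.pending_ne_nil
      · exact h
    · intro i hk
      rcases hstep i with h | h | ⟨p, t, -, h⟩ | ⟨h, -⟩
      · obtain ⟨t, ht⟩ := (M.callTrans_spec _ _ _ _ h).1
        exact absurd (Eq.symm (hk.symm.trans ht)) (by simp)
      · exact h
      · obtain ⟨t, ht⟩ := M.retTrans_spec _ _ _ _ h
        exact absurd (Eq.symm (hk.symm.trans ht)) (by simp)
      · obtain ⟨t, ht⟩ := M.retTrans_spec _ _ _ _ h
        exact absurd (Eq.symm (hk.symm.trans ht)) (by simp)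

theorem exists_isEMSO_of_automaton [Finite A] :
    ∃ φ : Formula A, φ.IsSentence ∧ φ.IsEMSO ∧ φ.language S = M.language := by
  obtain ⟨n, ⟨idx⟩⟩ := Finite.exists_equiv_fin (M.State × M.Stack)
  refine ⟨exSets (M.runFormula idx) n, (M.within_runFormula idx).isSentence_exSets,
    (M.within_runFormula idx).isEMSO_exSets n, Set.ext fun W => ?_⟩
  have key : ∀ w : ℕ → A, nested S w ∈ (exSets (M.runFormula idx) n).language S ↔
      w ∈ M.stringLanguage := by
    intro w
    rw [mem_stringLanguage_iff_exists_labelling]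
    constructor
    · intro h
      obtain ⟨V, -, h⟩ := sat_exSets.1 (h (fun _ => 0) fun _ => ∅)
      obtain ⟨ρ, -, h⟩ := (M.sat_runFormula idx w _ V).1 h
      exact ⟨ρ, h⟩
    · rintro ⟨ρ, h⟩ v V
      refine sat_exSets.2 ⟨fun X => if hX : X < n then {i | ρ i = idx.symm ⟨X, hX⟩} else V X,
        fun X hX => dif_neg (by omega), (M.sat_runFormula idx w v _).2 ⟨ρ, fun i e => ?_, h⟩⟩
      simp
  obtain ⟨w, rfl⟩ := W.exists_eq_nested
  rw [key]
  constructor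
  · exact fun h => ⟨w, h, rfl⟩
  · rintro ⟨w', h, he⟩
    obtain rfl : w' = w := congrArg InfNestedWord.lam he
    exact h

end BuchiMVPA

end AutomatonToFormula

end NestedWords

theorem mainTheorem5 {A : Type*} [Finite A] (S : NestedWords.CallReturnAlphabet 2 A)
    (L : Set (NestedWords.InfNestedWord S)) :
    (∃ M : NestedWords.BuchiMVPA S, M.language = L) ↔
      ∃ φ : NestedWords.Formula A, φ.IsSentence ∧ φ.IsEMSO ∧ φ.language S = L := by
  constructor
  · rintro ⟨M, rfl⟩
    exact M.exists_isEMSO_of_automaton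
  · rintro ⟨φ, hs, hφ, rfl⟩
    exact NestedWords.exists_automaton_of_isEMSO S hs hφ
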